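/- **Definitions.** All Hilbert spaces are complex and finite-dimensional, and $\omega_3=e^{2\pi i/3}$. The game $\mathcal{G}_3$ (the $\mathbb{Z}_3$ generalization of CHSH, given by the linear system $x_0x_1=1$, $x_0x_1=\omega_3$) is the following two-player game. Questions $(i,j)\in\{0,1\}^2$ are drawn uniformly, Alice receives $i$ and Bob receives $j$, and they answer with cube roots of unity $\alpha,\beta\in\{1,\omega_3,\omega_3^2\}$ respectively. They win iff $\alpha=\beta$ when $j=0$, iff $\alpha\beta=1$ when $(i,j)=(0,1)$, and iff $\alpha\beta=\omega_3$ when $(i,j)=(1,1)$. A quantum strategy consists of Hilbert spaces $\mathcal{H}_A,\mathcal{H}_B$, a unit vector $|\psi\rangle\in\mathcal{H}_A\otimes\mathcal{H}_B$, and projective measurements $\{E_{i,a}\}_{a=0,1,2}$ on $\mathcal{H}_A$ and $\{F_{j,b}\}_{b=0,1,2}$ on $\mathcal{H}_B$ for $i,j\in\{0,1\}$, where outcome $a$ stands for the answer $\omega_3^a$; the probability of outcomes $a,b$ on questions $i,j$ is $\langle\psi|E_{i,a}\otimes F_{j,b}|\psi\rangle$. The associated generalized observables are $A_i=\sum_a\omega_3^aE_{i,a}$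 and $B_j=\sum_b\omega_3^bF_{j,b}$; they are unitaries with $A_i^3=I$, $B_j^3=I$, and they determine the measurements. The quantum value $\nu^*(\mathcal{G}_3)$ is the supremum of the winning probability over all quantum strategies, and a strategy is optimal if it attains $\nu^*(\mathcal{G}_3)$. Let $z=e^{i\pi/6}$ and let $\mathcal{S}_3$ be the strategy on $\mathbb{C}^3\otimes\mathbb{C}^3$ with state $$|\psi_3\rangle=\tfrac1{\sqrt{10}}\big((1-z^4)|00\rangle+2|12\rangle+(1+z^2)|21\rangle\big)$$ and generalized observables $$A_0=B_0=\begin{pmatrix}0&0&1\\1&0&0\\0&1&0\end{pmatrix},\quad A_1=\begin{pmatrix}0&0&-z^2\\z^2&0&0\\0&z^2&0\end{pmatrix},\quad B_1=\begin{pmatrix}0&-z^2&0\\0&0&z^2\\z^2&0&0\end{pmatrix}.$$ **Theorem.** $\mathcal{G}_3$ is an exact self-test for $\mathcal{S}_3$, that is: 1. $\mathcal{S}_3$ is optimal for $\mathcal{G}_3$. 2. For every optimal strategy for $\mathcal{G}_3$, with state $|\tilde\psi\rangle\in\tilde{\mathcal{H}}_A\otimes\tilde{\mathcal{H}}_B$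 and observables $\tilde A_0,\tilde A_1,\tilde B_0,\tilde B_1$, there are Hilbert spaces $\mathcal{J}_A,\mathcal{J}_B$, isometries $V_A:\tilde{\mathcal{H}}_A\to\mathbb{C}^3\otimes\mathcal{J}_A$ and $V_B:\tilde{\mathcal{H}}_B\to\mathbb{C}^3\otimes\mathcal{J}_B$, and a unit vector $|\mathrm{junk}\rangle\in\mathcal{J}_A\otimes\mathcal{J}_B$ such that, identifying $(\mathbb{C}^3\otimes\mathcal{J}_A)\otimes(\mathbb{C}^3\otimes\mathcal{J}_B)$ with $(\mathbb{C}^3\otimes\mathbb{C}^3)\otimes(\mathcal{J}_A\otimes\mathcal{J}_B)$, $$(V_A\otimes V_B)|\tilde\psi\rangle=|\psi_3\rangle|\mathrm{junk}\rangle,$$ $$(V_A\tilde A_i\otimes V_B)|\tilde\psi\rangle=\big((A_i\otimes I)|\psi_3\rangle\big)|\mathrm{junk}\rangle\quad(i=0,1),$$ $$(V_A\otimes V_B\tilde B_j)|\tilde\psi\rangle=\big((I\otimes B_j)|\psi_3\rangle\big)|\mathrm{junk}\rangle\quad(j=0,1).$$ -/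

import Mathlib

open scoped TensorProduct

noncomputable section

/-- A two-player one-round game: a probability distribution on pairs of questions and a
`{0,1}`-valued winning predicate. -/
structure NonlocalGame (IA IB OA OB : Type) [Fintype IA] [Fintype IB] where
  prob : IA → IB → ℝ
  prob_nonneg : ∀ i j, 0 ≤ prob i j
  prob_sum : ∑ i, ∑ j, prob i j = 1
  V : IA → IB → OA → OB → Bool

/-- A quantum strategy on the Hilbert spaces `HA`, `HB`: a unit vector of `HA ⊗ HB` and, for each
question of each player, a projective measurement indexed by the answers. -/
structure QuantumStrategy (IA IB OA OB : Type) [Fintype OA] [Fintype OB]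
    (HA : Type*) (HB : Type*) [NormedAddCommGroup HA] [InnerProductSpace ℂ HA]
    [NormedAddCommGroup HB] [InnerProductSpace ℂ HB] where
  psi : HA ⊗[ℂ] HB
  norm_psi : ‖psi‖ = 1
  E : IA → OA → HA →ₗ[ℂ] HA
  E_proj : ∀ i a, (E i a).IsSymmetricProjection
  E_sum : ∀ i, ∑ a, E i a = LinearMap.id
  F : IB → OB → HB →ₗ[ℂ] HB
  F_proj : ∀ j b, (F j b).IsSymmetricProjection
  F_sum : ∀ j, ∑ b, F j b = LinearMap.id

namespace QuantumStrategy

variable {IA IB OA OB : Type} [Fintype IA] [Fintype IB] [Fintype OA] [Fintype OB]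
  {HA : Type*} {HB : Type*} [NormedAddCommGroup HA] [InnerProductSpace ℂ HA]
  [NormedAddCommGroup HB] [InnerProductSpace ℂ HB]

/-- The probability `⟨ψ| E_{i,a} ⊗ F_{j,b} |ψ⟩` of the answers `(a, b)` on the questions `(i, j)`. -/
def answerProb (S : QuantumStrategy IA IB OA OB HA HB) (i : IA) (j : IB) (a : OA) (b : OB) : ℝ :=
  (inner ℂ S.psi (TensorProduct.map (S.E i a) (S.F j b) S.psi)).re

/-- The winning probability of the strategy in the game. -/
def winProb (S : QuantumStrategy IA IB OA OB HA HB) (G : NonlocalGame IA IB OA OB) : ℝ :=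
  ∑ i, ∑ j, ∑ a, ∑ b, G.prob i j * S.answerProb i j a b * (if G.V i j a b then 1 else 0)

end QuantumStrategy

/-- The quantum value: the supremum of the winning probabilities of all quantum strategies on
finite-dimensional Hilbert spaces. -/
def NonlocalGame.quantumValue {IA IB OA OB : Type} [Fintype IA] [Fintype IB] [Fintype OA]
    [Fintype OB] (G : NonlocalGame IA IB OA OB) : ℝ :=
  sSup {p : ℝ | ∃ (HA HB : Type) (_ : NormedAddCommGroup HA) (_ : InnerProductSpace ℂ HA)
    (_ : FiniteDimensional ℂ HA) (_ : NormedAddCommGroup HB) (_ : InnerProductSpace ℂ HB)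
    (_ : FiniteDimensional ℂ HB) (S : QuantumStrategy IA IB OA OB HA HB), S.winProb G = p}

/-- The primitive `n`-th root of unity `e^{2πi/n}`. -/
def rootOfUnity (n : ℕ) : ℂ := Complex.exp (2 * Real.pi * Complex.I / n)

namespace QuantumStrategy

/-- A strategy is optimal if its winning probability is the quantum value of the game. -/
def IsOptimal {IA IB OA OB : Type} [Fintype IA] [Fintype IB] [Fintype OA] [Fintype OB]
    {HA : Type*} {HB : Type*} [NormedAddCommGroup HA] [InnerProductSpace ℂ HA]
    [NormedAddCommGroup HB] [InnerProductSpace ℂ HB]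
    (S : QuantumStrategy IA IB OA OB HA HB) (G : NonlocalGame IA IB OA OB) : Prop :=
  S.winProb G = G.quantumValue

variable {n : ℕ} [NeZero n] {IA IB : Type} {HA : Type*} {HB : Type*}
  [NormedAddCommGroup HA] [InnerProductSpace ℂ HA]
  [NormedAddCommGroup HB] [InnerProductSpace ℂ HB]

/-- Alice's generalized observable `A_i = ∑_a ω_n^a E_{i,a}`; the outcome `a` stands for the
answer `ω_n^a`. -/
def obsA (S : QuantumStrategy IA IB (ZMod n) (ZMod n) HA HB) (i : IA) : HA →ₗ[ℂ] HA :=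
  ∑ a : ZMod n, rootOfUnity n ^ a.val • S.E i a

/-- Bob's generalized observable `B_j = ∑_b ω_n^b F_{j,b}`. -/
def obsB (S : QuantumStrategy IA IB (ZMod n) (ZMod n) HA HB) (j : IB) : HB →ₗ[ℂ] HB :=
  ∑ b : ZMod n, rootOfUnity n ^ b.val • S.F j b

end QuantumStrategy

/-- The product vector `|ψ⟩|junk⟩`, with the tensor factors regrouped so that Alice holds
`KA ⊗ JA` and Bob holds `KB ⊗ JB`. -/
def withJunk {KA KB JA JB : Type*} [NormedAddCommGroup KA] [InnerProductSpace ℂ KA]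
    [NormedAddCommGroup KB] [InnerProductSpace ℂ KB] [NormedAddCommGroup JA]
    [InnerProductSpace ℂ JA] [NormedAddCommGroup JB] [InnerProductSpace ℂ JB]
    (psi : KA ⊗[ℂ] KB) (junk : JA ⊗[ℂ] JB) : (KA ⊗[ℂ] JA) ⊗[ℂ] (KB ⊗[ℂ] JB) :=
  TensorProduct.tensorTensorTensorComm ℂ KA KB JA JB (psi ⊗ₜ[ℂ] junk)

/-- The game `G` is an exact self-test for the strategy `S`: `S` is optimal, and for every optimal
strategy `T` (on finite-dimensional Hilbert spaces) there are local isometries `VA`, `VB` and a unit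
vector `junk` such that `(VA ⊗ VB)|ψ_T⟩ = |ψ_S⟩|junk⟩`, and likewise after applying any one
observable of either player. -/
def IsExactSelfTest.{u, v, w, x} {n : ℕ} [NeZero n] {IA IB : Type} [Fintype IA] [Fintype IB]
    {KA : Type w} {KB : Type x} [NormedAddCommGroup KA] [InnerProductSpace ℂ KA]
    [NormedAddCommGroup KB] [InnerProductSpace ℂ KB]
    (G : NonlocalGame IA IB (ZMod n) (ZMod n))
    (S : QuantumStrategy IA IB (ZMod n) (ZMod n) KA KB) : Prop :=
  S.IsOptimal G ∧
  ∀ (HA : Type u) (HB : Type v) [NormedAddCommGroup HA] [InnerProductSpace ℂ HA]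
    [FiniteDimensional ℂ HA] [NormedAddCommGroup HB] [InnerProductSpace ℂ HB]
    [FiniteDimensional ℂ HB] (T : QuantumStrategy IA IB (ZMod n) (ZMod n) HA HB),
    T.IsOptimal G →
    ∃ (dA dB : ℕ) (VA : HA →ₗᵢ[ℂ] KA ⊗[ℂ] EuclideanSpace ℂ (Fin dA))
      (VB : HB →ₗᵢ[ℂ] KB ⊗[ℂ] EuclideanSpace ℂ (Fin dB))
      (junk : EuclideanSpace ℂ (Fin dA) ⊗[ℂ] EuclideanSpace ℂ (Fin dB)),
      ‖junk‖ = 1 ∧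
      TensorProduct.map VA.toLinearMap VB.toLinearMap T.psi = withJunk S.psi junk ∧
      (∀ i, TensorProduct.map (VA.toLinearMap ∘ₗ T.obsA i) VB.toLinearMap T.psi =
        withJunk (TensorProduct.map (S.obsA i) LinearMap.id S.psi) junk) ∧
      (∀ j, TensorProduct.map VA.toLinearMap (VB.toLinearMap ∘ₗ T.obsB j) T.psi =
        withJunk (TensorProduct.map LinearMap.id (S.obsB j) S.psi) junk)

/-! ### From generalized observables to projective measurements -/

/-- The projection `(1/n) ∑_k (ω_n^{-a} U)^k` onto the `ω_n^a`-eigenspace of an operator `U`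
with `U^n = 1`. -/
def spectralProj {R : Type*} [Ring R] [Algebra ℂ R] (n : ℕ) (U : R) (a : ZMod n) : R :=
  (n : ℂ)⁻¹ • ∑ k ∈ Finset.range n, ((rootOfUnity n ^ a.val)⁻¹ • U) ^ k

theorem rootOfUnity_isPrimitiveRoot (n : ℕ) [NeZero n] : IsPrimitiveRoot (rootOfUnity n) n :=
  Complex.isPrimitiveRoot_exp n (NeZero.ne n)

theorem star_rootOfUnity (n : ℕ) : star (rootOfUnity n) = (rootOfUnity n)⁻¹ := by
  rw [rootOfUnity, ← Complex.exp_neg, Complex.star_def, ← Complex.exp_conj]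
  congr 1
  rw [map_div₀, map_mul, map_mul, Complex.conj_I, Complex.conj_ofReal, Complex.conj_natCast,
    map_ofNat]
  ring

theorem average_mul {R : Type*} [Ring R] {n : ℕ} {W : R} (hW : W ^ n = 1) :
    W * ∑ k ∈ Finset.range n, W ^ k = ∑ k ∈ Finset.range n, W ^ k := by
  have h1 := Finset.sum_range_succ (fun k => W ^ k) n
  have h2 := Finset.sum_range_succ' (fun k => W ^ k) n
  rw [h1] at h2
  simp only [hW, pow_zero, pow_succ', ← Finset.mul_sum] at h2
  exact (add_right_cancel h2).symm

section spectral

variable {R : Type*} [Ring R] [Algebra ℂ R] {n : ℕ} [NeZero n] {U : R}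

theorem rootOfUnity_smul_pow (hU : U ^ n = 1) (a : ℕ) :
    ((rootOfUnity n ^ a)⁻¹ • U) ^ n = 1 := by
  rw [smul_pow, hU, inv_pow, ← pow_mul, mul_comm, pow_mul,
    (rootOfUnity_isPrimitiveRoot n).pow_eq_one, one_pow, inv_one, one_smul]

theorem spectralProj_idem (hU : U ^ n = 1) (a : ZMod n) :
    spectralProj n U a * spectralProj n U a = spectralProj n U a := by
  have hW := rootOfUnity_smul_pow hU a.val
  unfold spectralProj
  set W := (rootOfUnity n ^ a.val)⁻¹ • U
  have hk : ∀ k, W ^ k * ∑ k ∈ Finset.range n, W ^ k = ∑ k ∈ Finset.range n, W ^ k := by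
    intro k
    induction k with
    | zero => simp
    | succ k ih => rw [pow_succ, mul_assoc, average_mul hW, ih]
  have hn : (n : ℂ) ≠ 0 := Nat.cast_ne_zero.2 (NeZero.ne n)
  rw [smul_mul_smul_comm, Finset.sum_mul, Finset.sum_congr rfl (fun k _ => hk k),
    Finset.sum_const, Finset.card_range, ← Nat.cast_smul_eq_nsmul ℂ, smul_smul]
  congr 1
  field_simp

theorem spectralProj_star [StarRing R] [StarModule ℂ R] (hs : star U * U = 1) (hU : U ^ n = 1)
    (a : ZMod n) : star (spectralProj n U a) = spectralProj n U a := by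
  have hW := rootOfUnity_smul_pow hU a.val
  have hsW : star ((rootOfUnity n ^ a.val)⁻¹ • U) * ((rootOfUnity n ^ a.val)⁻¹ • U) = 1 := by
    have h0 : rootOfUnity n ^ a.val ≠ 0 := pow_ne_zero _ (Complex.exp_ne_zero _)
    rw [star_smul, smul_mul_smul_comm, hs, star_inv₀, star_pow, star_rootOfUnity, inv_pow, inv_inv,
      mul_inv_cancel₀ h0, one_smul]
  unfold spectralProj
  set W := (rootOfUnity n ^ a.val)⁻¹ • U
  have h1 : star W = W ^ (n - 1) := by
    have : W * W ^ (n - 1) = 1 := by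
      rw [← pow_succ', Nat.sub_add_cancel (NeZero.one_le), hW]
    calc star W = star W * (W * W ^ (n - 1)) := by rw [this, mul_one]
      _ = W ^ (n - 1) := by rw [← mul_assoc, hsW, one_mul]
  have h2 : W ^ (n - 1) * (∑ k ∈ Finset.range n, star W ^ k) = ∑ k ∈ Finset.range n, W ^ k := by
    rw [← Finset.sum_range_reflect (fun k => W ^ k), Finset.mul_sum]
    refine Finset.sum_congr rfl fun k hk => ?_
    have hk' := Finset.mem_range.1 hk
    have hs2 : ∀ k, W ^ k * star W ^ k = 1 := by
      intro k
      have hc : Commute W (star W) := by rw [h1]; exact Commute.self_pow W _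
      rw [← hc.mul_pow, hc.eq, hsW, one_pow]
    rw [show n - 1 = (n - 1 - k) + k by omega, pow_add, mul_assoc, hs2, mul_one]
    congr 1
    omega
  have h3 : star W * ∑ k ∈ Finset.range n, star W ^ k = ∑ k ∈ Finset.range n, star W ^ k :=
    average_mul (by rw [← star_pow, hW, star_one])
  rw [star_smul, star_sum]
  simp only [star_pow]
  rw [← h2, ← h1, h3]
  simp

theorem sum_rootOfUnity_inv_pow (k : ℕ) (hk : k < n) :
    ∑ a : ZMod n, ((rootOfUnity n ^ a.val)⁻¹) ^ k = if k = 0 then (n : ℂ) else 0 := by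
  have hz := (rootOfUnity_isPrimitiveRoot n).inv
  have h1 : ∑ a : ZMod n, ((rootOfUnity n ^ a.val)⁻¹) ^ k =
      ∑ j ∈ Finset.range n, (((rootOfUnity n)⁻¹) ^ k) ^ j := by
    refine Finset.sum_bij (fun a _ => a.val) (fun a _ => Finset.mem_range.2 a.val_lt)
      (fun a _ b _ h => ZMod.val_injective n h)
      (fun j hj => ⟨(j : ZMod n), Finset.mem_univ _,
        ZMod.val_cast_of_lt (Finset.mem_range.1 hj)⟩) (fun a _ => ?_)
    rw [← inv_pow, ← pow_mul, ← pow_mul, mul_comm]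
  rw [h1]
  split_ifs with h
  · simp [h]
  · have hne : ((rootOfUnity n)⁻¹) ^ k ≠ 1 := hz.pow_ne_one_of_pos_of_lt h hk
    rw [geom_sum_eq hne, ← pow_mul, mul_comm, pow_mul, hz.pow_eq_one]
    simp

theorem spectralProj_sum (U : R) : ∑ a : ZMod n, spectralProj n U a = 1 := by
  have hn : (n : ℂ) ≠ 0 := Nat.cast_ne_zero.2 (NeZero.ne n)
  unfold spectralProj
  rw [← Finset.smul_sum, Finset.sum_comm]
  have : ∀ k ∈ Finset.range n, ∑ a : ZMod n, ((rootOfUnity n ^ a.val)⁻¹ • U) ^ k =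
      if k = 0 then (n : ℂ) • (1 : R) else 0 := by
    intro k hk
    simp only [smul_pow]
    rw [← Finset.sum_smul, sum_rootOfUnity_inv_pow k (Finset.mem_range.1 hk)]
    split_ifs with h <;> simp [h]
  rw [Finset.sum_congr rfl this, Finset.sum_ite_eq' (Finset.range n)]
  simp [NeZero.pos n, smul_smul, hn]

/-- The observable assigned to the spectral projections of `U` is `U` itself. -/
theorem spectralProj_observable (hU : U ^ n = 1) :
    ∑ a : ZMod n, rootOfUnity n ^ a.val • spectralProj n U a = U := by
  have h : ∀ a : ZMod n, rootOfUnity n ^ a.val • spectralProj n U a = U * spectralProj n U a := by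
    intro a
    have h0 : rootOfUnity n ^ a.val ≠ 0 := pow_ne_zero _ (Complex.exp_ne_zero _)
    have hW := average_mul (rootOfUnity_smul_pow hU a.val)
    unfold spectralProj
    rw [mul_smul_comm, smul_comm]
    congr 1
    conv_lhs => rw [← hW]
    rw [smul_mul_assoc, smul_smul, mul_inv_cancel₀ h0, one_smul]
  rw [Finset.sum_congr rfl fun a _ => h a, ← Finset.mul_sum, spectralProj_sum, mul_one]

end spectral

namespace QuantumStrategy

variable {n : ℕ} [NeZero n] {IA IB : Type} {HA : Type*} {HB : Type*}
  [NormedAddCommGroup HA] [InnerProductSpace ℂ HA] [FiniteDimensional ℂ HA]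
  [NormedAddCommGroup HB] [InnerProductSpace ℂ HB] [FiniteDimensional ℂ HB]

/-- The strategy given by a unit vector and generalized observables of order `n`
(unitaries `U` with `U^n = 1`). -/
def ofObservables (A : IA → HA →ₗ[ℂ] HA) (hA : ∀ i, LinearMap.adjoint (A i) ∘ₗ A i = LinearMap.id)
    (hAn : ∀ i, A i ^ n = 1)
    (B : IB → HB →ₗ[ℂ] HB) (hB : ∀ j, LinearMap.adjoint (B j) ∘ₗ B j = LinearMap.id)
    (hBn : ∀ j, B j ^ n = 1) (psi : HA ⊗[ℂ] HB) (hpsi : ‖psi‖ = 1) :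
    QuantumStrategy IA IB (ZMod n) (ZMod n) HA HB where
  psi := psi
  norm_psi := hpsi
  E i a := spectralProj n (A i) a
  E_proj i a := LinearMap.isStarProjection_iff_isSymmetricProjection.1
    ⟨spectralProj_idem (hAn i) a, spectralProj_star (hA i) (hAn i) a⟩
  E_sum i := spectralProj_sum (A i)
  F j b := spectralProj n (B j) b
  F_proj j b := LinearMap.isStarProjection_iff_isSymmetricProjection.1
    ⟨spectralProj_idem (hBn j) b, spectralProj_star (hB j) (hBn j) b⟩
  F_sum j := spectralProj_sum (B j)

end QuantumStrategy

/-! ### The game `𝒢_n` and the strategy `𝒮_3` -/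

/-- The `ℤ_n` generalization of CHSH: the linear constraint game of the system `x₀x₁ = 1`,
`x₀x₁ = ω_n`. Questions are uniform on `{0,1} × {0,1}`, an answer `ω_n^a` is recorded by its
exponent `a`. -/
def gameZ (n : ℕ) : NonlocalGame (Fin 2) (Fin 2) (ZMod n) (ZMod n) where
  prob _ _ := 1 / 4
  prob_nonneg _ _ := by norm_num
  prob_sum := by norm_num
  V i j a b :=
    if j = 0 then decide (a = b)
    else if i = 0 then decide (a + b = 0)
    else decide (a + b = 1)

/-- `z = e^{iπ/6}`, a primitive twelfth root of unity. -/
def z12 : ℂ := Complex.exp (Real.pi * Complex.I / 6)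

/-- Alice's observables in `𝒮_3`. -/
def matA : Fin 2 → Matrix (Fin 3) (Fin 3) ℂ :=
  ![!![0, 0, 1; 1, 0, 0; 0, 1, 0],
    !![0, 0, -z12 ^ 2; z12 ^ 2, 0, 0; 0, z12 ^ 2, 0]]

/-- Bob's observables in `𝒮_3`. -/
def matB : Fin 2 → Matrix (Fin 3) (Fin 3) ℂ :=
  ![!![0, 0, 1; 1, 0, 0; 0, 1, 0],
    !![0, -z12 ^ 2, 0; 0, 0, z12 ^ 2; z12 ^ 2, 0, 0]]

/-- The product basis vector `|i⟩|j⟩` of `ℂ³ ⊗ ℂ³`. -/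
def ket (i j : Fin 3) : EuclideanSpace ℂ (Fin 3) ⊗[ℂ] EuclideanSpace ℂ (Fin 3) :=
  EuclideanSpace.single i 1 ⊗ₜ[ℂ] EuclideanSpace.single j 1

/-- The shared state of `𝒮_3`. -/
def psi3 : EuclideanSpace ℂ (Fin 3) ⊗[ℂ] EuclideanSpace ℂ (Fin 3) :=
  (1 / (Real.sqrt 10 : ℂ)) •
    ((1 - z12 ^ 4) • ket 0 0 + (2 : ℂ) • ket 1 2 + (1 + z12 ^ 2) • ket 2 1)

theorem z12_sq : z12 ^ 2 = 1 / 2 + (Real.sqrt 3 / 2 : ℝ) * Complex.I := by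
  rw [z12, ← Complex.exp_nat_mul,
    show ((2 : ℕ) : ℂ) * (Real.pi * Complex.I / 6) = ((Real.pi / 3 : ℝ) : ℂ) * Complex.I by
      push_cast; ring,
    Complex.exp_mul_I, ← Complex.ofReal_cos, ← Complex.ofReal_sin, Real.cos_pi_div_three,
    Real.sin_pi_div_three]
  push_cast
  ring

theorem sqrt_three_sq : ((Real.sqrt 3 : ℝ) : ℂ) ^ 2 = 3 := by
  rw [← Complex.ofReal_pow, Real.sq_sqrt (by norm_num)]
  norm_num

theorem z12_pow_four : z12 ^ 4 = z12 ^ 2 - 1 := by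
  rw [show z12 ^ 4 = (z12 ^ 2) ^ 2 by ring, z12_sq]
  push_cast
  linear_combination (-1 / 4 : ℂ) * sqrt_three_sq + (Real.sqrt 3 : ℂ) ^ 2 / 4 * Complex.I_sq

theorem conj_z12_sq : (starRingEnd ℂ) (z12 ^ 2) = 1 - z12 ^ 2 := by
  rw [z12_sq]
  simp only [map_add, map_mul, Complex.conj_ofReal, Complex.conj_I, map_div₀, map_one, map_ofNat]
  ring

theorem conj_mul_z12_sq : (1 - z12 ^ 2) * z12 ^ 2 = 1 := by
  linear_combination -z12_pow_four

theorem matA_unitary (i : Fin 2) : (matA i).conjTranspose * matA i = 1 := by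
  have h := conj_mul_z12_sq
  have h' : -((z12 ^ 2 - 1) * z12 ^ 2) = 1 := by linear_combination h
  have hc := conj_z12_sq
  simp only [map_pow] at hc
  fin_cases i <;> ext a b <;> fin_cases a <;> fin_cases b <;>
    simp [matA, Matrix.mul_apply, Fin.sum_univ_three, hc, h, h']

theorem matB_unitary (i : Fin 2) : (matB i).conjTranspose * matB i = 1 := by
  have h := conj_mul_z12_sq
  have h' : -((z12 ^ 2 - 1) * z12 ^ 2) = 1 := by linear_combination h
  have hc := conj_z12_sq
  simp only [map_pow] at hc
  fin_cases i <;> ext a b <;> fin_cases a <;> fin_cases b <;>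
    simp [matB, Matrix.mul_apply, Fin.sum_univ_three, hc, h, h']

theorem matA_cube (i : Fin 2) : matA i ^ 3 = 1 := by
  have h : z12 ^ 2 * z12 ^ 2 * z12 ^ 2 = -1 := by
    linear_combination (z12 ^ 2 + 1) * z12_pow_four
  rw [pow_three']
  fin_cases i <;> ext a b <;> fin_cases a <;> fin_cases b <;>
    simp [matA, Matrix.mul_apply, Fin.sum_univ_three, h]

theorem matB_cube (i : Fin 2) : matB i ^ 3 = 1 := by
  have h : z12 ^ 2 * z12 ^ 2 * z12 ^ 2 = -1 := by
    linear_combination (z12 ^ 2 + 1) * z12_pow_four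
  rw [pow_three']
  fin_cases i <;> ext a b <;> fin_cases a <;> fin_cases b <;>
    simp [matB, Matrix.mul_apply, Fin.sum_univ_three, h]

theorem adjoint_toEuclideanLin_comp {M : Matrix (Fin 3) (Fin 3) ℂ}
    (hM : M.conjTranspose * M = 1) :
    LinearMap.adjoint (Matrix.toEuclideanLin M) ∘ₗ Matrix.toEuclideanLin M = LinearMap.id := by
  rw [← Matrix.toEuclideanLin_conjTranspose_eq_adjoint, ← Matrix.toLpLin_mul_same, hM,
    Matrix.toLpLin_one]

theorem toEuclideanLin_cube {M : Matrix (Fin 3) (Fin 3) ℂ} (hM : M ^ 3 = 1) :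
    Matrix.toEuclideanLin M ^ 3 = 1 := by
  rw [← Matrix.toLpLin_pow, hM, Matrix.toLpLin_one]
  rfl

theorem norm_sq_combination {H : Type*} [NormedAddCommGroup H] [InnerProductSpace ℂ H]
    {x y z : H} (hx : ‖x‖ = 1) (hy : ‖y‖ = 1) (hz : ‖z‖ = 1) (hxy : inner ℂ x y = (0 : ℂ))
    (hxz : inner ℂ x z = (0 : ℂ)) (hyz : inner ℂ y z = (0 : ℂ)) (a b c : ℂ) :
    ‖a • x + b • y + c • z‖ ^ 2 = ‖a‖ ^ 2 + ‖b‖ ^ 2 + ‖c‖ ^ 2 := by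
  rw [pow_two, norm_add_sq_eq_norm_sq_add_norm_sq_of_inner_eq_zero (𝕜 := ℂ) (a • x + b • y) (c • z),
    norm_add_sq_eq_norm_sq_add_norm_sq_of_inner_eq_zero (𝕜 := ℂ) (a • x) (b • y)]
  · simp only [norm_smul, hx, hy, hz]
    ring
  · simp [inner_smul_left, inner_smul_right, hxy]
  · simp [inner_add_left, inner_smul_left, inner_smul_right, hxz, hyz]

theorem norm_ket (i j : Fin 3) : ‖ket i j‖ = 1 := by
  simp [ket]

theorem inner_ket_eq_zero {i j k l : Fin 3} (h : i ≠ k) : inner ℂ (ket i j) (ket k l) = (0 : ℂ) := by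
  refine (TensorProduct.inner_tmul (𝕜 := ℂ) _ _ _ _).trans ?_
  rw [EuclideanSpace.inner_single_left, PiLp.single_apply, if_neg h, mul_zero, zero_mul]

theorem norm_psi3 : ‖psi3‖ = 1 := by
  have hc := conj_z12_sq
  have h1 : ‖1 + z12 ^ 2‖ ^ 2 = 3 := by
    have : ((‖1 + z12 ^ 2‖ ^ 2 : ℝ) : ℂ) = 3 := by
      rw [Complex.ofReal_pow, ← Complex.conj_mul', map_add, hc, map_one]
      linear_combination -z12_pow_four
    exact_mod_cast this
  have h2 : ‖1 - z12 ^ 4‖ ^ 2 = 3 := by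
    have : ((‖1 - z12 ^ 4‖ ^ 2 : ℝ) : ℂ) = 3 := by
      rw [Complex.ofReal_pow, ← Complex.conj_mul', z12_pow_four, map_sub, map_sub, hc, map_one]
      linear_combination -z12_pow_four
    exact_mod_cast this
  have h3 := norm_sq_combination (norm_ket 0 0) (norm_ket 1 2) (norm_ket 2 1)
    (inner_ket_eq_zero (by decide)) (inner_ket_eq_zero (by decide)) (inner_ket_eq_zero (by decide))
    (1 - z12 ^ 4) 2 (1 + z12 ^ 2)
  rw [h1, h2] at h3
  norm_num at h3
  have h4 : ‖psi3‖ ^ 2 = 1 := by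
    have h5 : ‖psi3‖ = ‖(1 / (Real.sqrt 10 : ℂ))‖ *
        ‖(1 - z12 ^ 4) • ket 0 0 + (2 : ℂ) • ket 1 2 + (1 + z12 ^ 2) • ket 2 1‖ := norm_smul _ _
    rw [h5, mul_pow, h3, norm_div, norm_one, Complex.norm_real, Real.norm_of_nonneg (by positivity),
      div_pow, Real.sq_sqrt (by norm_num)]
    norm_num
  exact (pow_eq_one_iff_of_nonneg (norm_nonneg _) two_ne_zero).1 h4

/-- The strategy `𝒮_3`, given by its observables. -/
def strategy3 : QuantumStrategy (Fin 2) (Fin 2) (ZMod 3) (ZMod 3)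
    (EuclideanSpace ℂ (Fin 3)) (EuclideanSpace ℂ (Fin 3)) :=
  QuantumStrategy.ofObservables
    (fun i => Matrix.toEuclideanLin (matA i)) (fun i => adjoint_toEuclideanLin_comp (matA_unitary i))
    (fun i => toEuclideanLin_cube (matA_cube i))
    (fun j => Matrix.toEuclideanLin (matB j)) (fun j => adjoint_toEuclideanLin_comp (matB_unitary j))
    (fun j => toEuclideanLin_cube (matB_cube j))
    psi3 norm_psi3

theorem strategy3_obsA (i : Fin 2) : strategy3.obsA i = Matrix.toEuclideanLin (matA i) :=
  spectralProj_observable (toEuclideanLin_cube (matA_cube i))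

theorem strategy3_obsB (j : Fin 2) : strategy3.obsB j = Matrix.toEuclideanLin (matB j) :=
  spectralProj_observable (toEuclideanLin_cube (matB_cube j))

end

universe u v

open scoped TensorProduct

/-! Put ζ = e^{iπ/3} = `z12 ^ 2` and absorb phases: a₀ = A₀, a₁ = ζ⁻¹A₁, b₀ = B₀, b₁ = ζB₁†, so that
a₀³ = b₀³ = 1 and a₁³ = b₁³ = -1. The indicator of x = 1 among cube roots of unity is (1 + 2 Re
x)/3, so the winning probability is 1/3 + Re⟨K⟩/6 with K = a₀b₀† + a₁b₁† + ζ(a₀b₁† + a₁b₀†)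
(`winProb_gameZ_three`). A sum-of-squares identity for 6 - K - K† gives Re⟨K⟩ ≤ 3 (`sum_of_squares`,
`re_inner_biasOperator_le`); 𝒮₃ reaches 3, so the quantum value is 5/6.

At an optimal ψ every square annihilates ψ. With D = a₁a₀† and E = a₀†a₁ = a₀†Da₀ this yields D²ψ =
ψ, (1 - D)(1 - E)ψ = 0, and formulas turning D, E and a₀ on ψ into operators of Bob
(`isMaximalState_of_inner_eq`). Hence Alice's support W of ψ is invariant under a₀ and D, and
relations on ψ become operator identities on W.

On W, a₁³ = -1 says that D, G = a₀Da₀† and E satisfy DGE = -1; with (1 - D)(1 - E) = 0 this forces D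
+ G + E = 1. So the -1-eigenprojections of the three involutions D, G, E sum to the identity and are
permuted cyclically by a₀: W embeds in ℂ³ ⊗ J, with a₀ acting as a cyclic shift and a₁ = Da₀ as a
signed one (`exists_isometry`). Bob's side is the same with b₀ and b₀†b₁. Comparing eigenvalues
across the two sides leaves only the components |00⟩, |12⟩, |21⟩, and the linear relations fix their
ratios to those of |ψ₃⟩ (`components`, `exists_isometries`). -/

/-- `u` and `v` are unitary, `u ^ 3 = 1` and `v ^ 3 = -1`. -/
structure IsCubicPair {R : Type*} [Ring R] [StarRing R] (u v : R) : Prop where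
  star_u_mul : star u * u = 1
  u_mul_star : u * star u = 1
  u_sq : u * u = star u
  star_v_mul : star v * v = 1
  v_mul_star : v * star v = 1
  v_sq : v * v = -star v

namespace IsCubicPair

variable {R : Type*} [Ring R] [StarRing R] {u v : R}

theorem star_u_sq (h : IsCubicPair u v) : star u * star u = u := by
  have := congrArg star h.u_sq
  rwa [star_mul, star_star] at this

theorem star_v_sq (h : IsCubicPair u v) : star v * star v = -v := by
  have := congrArg star h.v_sq
  rwa [star_mul, star_neg, star_star] at this

end IsCubicPair

/-! ### The sum-of-squares identity. -/

section SumOfSquares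

set_option maxHeartbeats 2000000 in
/-- The sum-of-squares decomposition of `6 - K - K†`, where `K = U + ζ V`, in a ring spanned by
products `m x y` of commuting elements. -/
theorem sum_of_squares {RA RB R : Type*} [Ring RA] [StarRing RA] [Ring RB] [StarRing RB] [Ring R]
    [Algebra ℂ R] {m : RA → RB → R} (hm : ∀ x x' y y', m x y * m x' y' = m (x * x') (y * y'))
    (hone : m 1 1 = 1) (hnl : ∀ x y, m (-x) y = -m x y) (hnr : ∀ x y, m x (-y) = -m x y)
    {a0 a1 : RA} {b0 b1 : RB} (ha : IsCubicPair a0 a1) (hb : IsCubicPair b0 b1) {ζ ζ' : ℂ}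
    (h1 : ζ' = 1 - ζ) (h2 : ζ ^ 2 = ζ - 1) {U V U' V' T1 T1' T2 T2' : R}
    (hU : U = m a0 (star b0) + m a1 (star b1)) (hV : V = m a0 (star b1) + m a1 (star b0))
    (hU' : U' = m (star a0) b0 + m (star a1) b1) (hV' : V' = m (star a0) b1 + m (star a1) b0)
    (hT1 : T1 = m a0 (star b1) - m a1 (star b0)) (hT1' : T1' = m (star a0) b1 - m (star a1) b0)
    (hT2 : T2 = m a0 (star b0) - m a1 (star b1)) (hT2' : T2' = m (star a0) b0 - m (star a1) b1) :
    (258 : ℂ) • ((6 : ℂ) • 1 - (U + ζ • V) - (U' + ζ' • V')) =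
      (21 : ℂ) • (((6 : ℂ) • 1 - (U + ζ • V) - (U' + ζ' • V')) *
        ((6 : ℂ) • 1 - (U + ζ • V) - (U' + ζ' • V'))) +
      ((5 * ζ - 1) • U + (ζ - 5) • V + (5 * ζ' - 1) • U' + (ζ' - 5) • V') *
        ((5 * ζ - 1) • U + (ζ - 5) • V + (5 * ζ' - 1) • U' + (ζ' - 5) • V') +
      (15 : ℂ) • ((m (star a0) 1 - m (star a1) 1 - ζ' • (m 1 (star b0) - m 1 (star b1))) *
        (m a0 1 - m a1 1 - ζ • (m 1 b0 - m 1 b1))) +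
      (15 : ℂ) • ((ζ' • (m a0 1 - m a1 1) - (m 1 b0 - m 1 b1)) *
        (ζ • (m (star a0) 1 - m (star a1) 1) - (m 1 (star b0) - m 1 (star b1)))) +
      (42 : ℂ) • (T1' * T1 + T1 * T1' + T2' * T2 + T2 * T2') +
      (3 * (5 * ζ - 1)) • (T2 * T2) + (3 * (5 * ζ' - 1)) • (T2' * T2') +
      (3 * (1 + 4 * ζ)) • (T1 * T1) + (3 * (1 + 4 * ζ')) • (T1' * T1') := by
  subst h1 hU hV hU' hV' hT1 hT1' hT2 hT2'
  simp only [mul_add, add_mul, mul_sub, sub_mul, smul_mul_assoc, mul_smul_comm, hm,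
    one_mul, mul_one, ha.star_u_mul, ha.u_mul_star, ha.u_sq, ha.star_v_mul, ha.v_mul_star, ha.v_sq,
    hb.star_u_mul, hb.u_mul_star, hb.u_sq, hb.star_v_mul, hb.v_mul_star, hb.v_sq, ha.star_u_sq,
    ha.star_v_sq, hb.star_u_sq, hb.star_v_sq, hnl, hnr, hone, neg_neg]
  -- Both sides are now combinations of reduced words `m x y`; equality of coefficients is
  -- polynomial arithmetic modulo ζ² = ζ - 1.
  match_scalars
  all_goals ring_nf
  all_goals simp only [h2]
  all_goals ring_nf

end SumOfSquares

theorem re_mul_inner_ge {H : Type*} [NormedAddCommGroup H] [InnerProductSpace ℂ H] (x y : H)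
    {c : ℂ} {r : ℝ} (hc : ‖c‖ ≤ r) : -(r * (‖x‖ * ‖y‖)) ≤ (c * inner ℂ x y).re := by
  have h1 : |(c * inner ℂ x y).re| ≤ r * (‖x‖ * ‖y‖) := by
    refine (Complex.abs_re_le_norm _).trans ?_
    rw [norm_mul]
    exact mul_le_mul hc (norm_inner_le_norm x y) (norm_nonneg _) ((norm_nonneg c).trans hc)
  exact (abs_le.1 h1).1

theorem inner_star_mul {H : Type*} [NormedAddCommGroup H] [InnerProductSpace ℂ H]
    [FiniteDimensional ℂ H] {X Y : Module.End ℂ H} (h : star X = Y) (Z : Module.End ℂ H) (ψ : H) :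
    inner ℂ ψ ((Y * Z) ψ) = inner ℂ (X ψ) (Z ψ) := by
  rw [← h]
  exact LinearMap.adjoint_inner_right X ψ (Z ψ)

theorem re_inner_self {H : Type*} [NormedAddCommGroup H] [InnerProductSpace ℂ H] (x : H) :
    (inner ℂ x x).re = ‖x‖ ^ 2 := by
  rw [inner_self_eq_norm_sq_to_K]
  norm_cast

/-- All four numbers have squared modulus 21. They weight the cross terms T² in the sum of squares,
and the rational bound 5 is good enough there. -/
theorem norm_le_five_of_sq {ζ ζ' : ℂ} (h0 : star ζ = ζ') (h1 : ζ' = 1 - ζ) (h2 : ζ ^ 2 = ζ - 1) :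
    ‖5 * ζ - 1‖ ≤ 5 ∧ ‖5 * ζ' - 1‖ ≤ 5 ∧ ‖1 + 4 * ζ‖ ≤ 5 ∧ ‖1 + 4 * ζ'‖ ≤ 5 := by
  have hs : ∀ c : ℂ, star c * c = 21 → ‖c‖ ≤ 5 := by
    intro c hc
    have : ((‖c‖ ^ 2 : ℝ) : ℂ) = 21 := by
      rw [← hc, Complex.ofReal_pow, ← Complex.conj_mul']
      rfl
    have h3 : ‖c‖ ^ 2 = 21 := by exact_mod_cast this
    nlinarith [norm_nonneg c]
  have h0' : star ζ' = ζ := by rw [← h0, star_star]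
  have hn : ∀ n : ℕ, star (n : ℂ) = n := fun n => star_natCast n
  have h4 := hn 4
  have h5 := hn 5
  push_cast at h4 h5
  refine ⟨hs _ ?_, hs _ ?_, hs _ ?_, hs _ ?_⟩ <;>
    simp only [star_sub, star_add, star_mul, star_one, h0, h0', h4, h5] <;>
    subst h1 <;> ring_nf <;> simp only [h2] <;> ring

/-! ### The bound Re⟨K⟩ ≤ 3. -/

section OptimalState

variable {RA RB H : Type*} [Ring RA] [StarRing RA] [Algebra ℂ RA] [Ring RB] [StarRing RB]
  [Algebra ℂ RB] [NormedAddCommGroup H] [InnerProductSpace ℂ H] [FiniteDimensional ℂ H]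

/-- `m x y` behaves like the operator `x ⊗ y`. -/
structure IsTensorAction (m : RA → RB → Module.End ℂ H) : Prop where
  mul : ∀ x x' y y', m x y * m x' y' = m (x * x') (y * y')
  one : m 1 1 = 1
  add_left : ∀ x x' y, m (x + x') y = m x y + m x' y
  add_right : ∀ x y y', m x (y + y') = m x y + m x y'
  smul_left : ∀ (c : ℂ) x y, m (c • x) y = c • m x y
  smul_right : ∀ (c : ℂ) x y, m x (c • y) = c • m x y
  star : ∀ x y, star (m x y) = m (star x) (star y)

namespace IsTensorAction

variable {m : RA → RB → Module.End ℂ H}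

theorem neg_left (hm : IsTensorAction m) (x : RA) (y : RB) : m (-x) y = -m x y := by
  rw [← neg_one_smul ℂ x, hm.smul_left, neg_one_smul]

theorem neg_right (hm : IsTensorAction m) (x : RA) (y : RB) : m x (-y) = -m x y := by
  rw [← neg_one_smul ℂ y, hm.smul_right, neg_one_smul]

theorem sub_left (hm : IsTensorAction m) (x x' : RA) (y : RB) :
    m (x - x') y = m x y - m x' y := by
  rw [sub_eq_add_neg, hm.add_left, hm.neg_left, sub_eq_add_neg]

theorem sub_right (hm : IsTensorAction m) (x : RA) (y y' : RB) :
    m x (y - y') = m x y - m x y' := by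
  rw [sub_eq_add_neg, hm.add_right, hm.neg_right, sub_eq_add_neg]

theorem apply (hm : IsTensorAction m) (x x' : RA) (y y' : RB) (ψ : H) :
    m x y (m x' y' ψ) = m (x * x') (y * y') ψ := by
  rw [← hm.mul, Module.End.mul_apply]

end IsTensorAction

/-- The operator `K = a₀b₀† + a₁b₁† + ζ (a₀b₁† + a₁b₀†)`. -/
def biasOperator (m : RA → RB → Module.End ℂ H) (ζ : ℂ)
    (a0 a1 : RA) (b0 b1 : RB) : Module.End ℂ H :=
  m a0 (star b0) + m a1 (star b1) + ζ • (m a0 (star b1) + m a1 (star b0))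

variable {m : RA → RB → Module.End ℂ H} {a0 a1 : RA} {b0 b1 : RB}

/-- This is the expectation of `sum_of_squares` in ψ. The terms T² are not positive, but they are
dominated by the T†T and TT† terms, so all the norms survive with positive weight; that is what
makes the equality case informative. -/
theorem sum_of_squares_le (hm : IsTensorAction m) (ha : IsCubicPair a0 a1)
    (hb : IsCubicPair b0 b1) {ζ ζ' : ℂ} (h0 : star ζ = ζ') (h1 : ζ' = 1 - ζ)
    (h2 : ζ ^ 2 = ζ - 1) {ψ : H} (hψ : ‖ψ‖ = 1) {U V U' V' T1 T1' T2 T2' : Module.End ℂ H}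
    (hU : U = m a0 (star b0) + m a1 (star b1)) (hV : V = m a0 (star b1) + m a1 (star b0))
    (hU' : U' = m (star a0) b0 + m (star a1) b1) (hV' : V' = m (star a0) b1 + m (star a1) b0)
    (hT1 : T1 = m a0 (star b1) - m a1 (star b0)) (hT1' : T1' = m (star a0) b1 - m (star a1) b0)
    (hT2 : T2 = m a0 (star b0) - m a1 (star b1)) (hT2' : T2' = m (star a0) b0 - m (star a1) b1) :
    21 * ‖((6 : ℂ) • 1 - (U + ζ • V) - (U' + ζ' • V')) ψ‖ ^ 2 +
      ‖((5 * ζ - 1) • U + (ζ - 5) • V + (5 * ζ' - 1) • U' + (ζ' - 5) • V') ψ‖ ^ 2 +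
      15 * ‖(m a0 1 - m a1 1 - ζ • (m 1 b0 - m 1 b1)) ψ‖ ^ 2 +
      15 * ‖(ζ • (m (star a0) 1 - m (star a1) 1) - (m 1 (star b0) - m 1 (star b1))) ψ‖ ^ 2 +
      27 * (‖T1 ψ‖ ^ 2 + ‖T1' ψ‖ ^ 2 + ‖T2 ψ‖ ^ 2 + ‖T2' ψ‖ ^ 2) ≤
    516 * (3 - (inner ℂ ψ (biasOperator m ζ a0 a1 b0 b1 ψ)).re) := by
  have key := sum_of_squares hm.mul hm.one hm.neg_left hm.neg_right ha hb h1 h2 hU hV hU' hV' hT1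
    hT1' hT2 hT2'
  have h0' : star ζ' = ζ := by rw [← h0, star_star]
  have hn : ∀ n : ℕ, star (n : ℂ) = n := fun n => star_natCast n
  have s5 := hn 5
  have s6 := hn 6
  push_cast at s5 s6
  have sU : star U = U' := by simp only [hU, hU', star_add, hm.star, star_star]
  have sV : star V = V' := by simp only [hV, hV', star_add, hm.star, star_star]
  have sU' : star U' = U := by rw [← sU, star_star]
  have sV' : star V' = V := by rw [← sV, star_star]
  have sT1 : star T1 = T1' := by simp only [hT1, hT1', star_sub, hm.star, star_star]
  have sT2 : star T2 = T2' := by simp only [hT2, hT2', star_sub, hm.star, star_star]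
  have sT1' : star T1' = T1 := by rw [← sT1, star_star]
  have sT2' : star T2' = T2 := by rw [← sT2, star_star]
  have sRa : star ((6 : ℂ) • (1 : Module.End ℂ H) - (U + ζ • V) - (U' + ζ' • V')) =
      (6 : ℂ) • 1 - (U + ζ • V) - (U' + ζ' • V') := by
    simp only [star_sub, star_add, star_smul, sU, sV, sU', sV', h0, h0', s6, star_one]
    abel
  have sRb : star ((5 * ζ - 1) • U + (ζ - 5) • V + (5 * ζ' - 1) • U' + (ζ' - 5) • V') =
      (5 * ζ - 1) • U + (ζ - 5) • V + (5 * ζ' - 1) • U' + (ζ' - 5) • V' := by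
    simp only [star_sub, star_add, star_smul, star_mul, sU, sV, sU', sV', h0, h0', s5, star_one,
      mul_comm _ (5 : ℂ)]
    abel
  have sS : star (m a0 1 - m a1 1 - ζ • (m 1 b0 - m 1 b1)) =
      m (star a0) 1 - m (star a1) 1 - ζ' • (m 1 (star b0) - m 1 (star b1)) := by
    simp only [star_sub, star_smul, hm.star, star_one, h0]
  have sS' : star (ζ • (m (star a0) 1 - m (star a1) 1) - (m 1 (star b0) - m 1 (star b1))) =
      ζ' • (m a0 1 - m a1 1) - (m 1 b0 - m 1 b1) := by
    simp only [star_sub, star_smul, hm.star, star_one, h0, star_star]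
  have hK : biasOperator m ζ a0 a1 b0 b1 = U + ζ • V := by rw [hU, hV, biasOperator]
  have sK : star (U' + ζ' • V') = U + ζ • V := by
    simp only [star_add, star_smul, sU', sV', h0']
  have hL : (inner ℂ ψ (((258 : ℂ) • ((6 : ℂ) • (1 : Module.End ℂ H) -
      (U + ζ • V) - (U' + ζ' • V'))) ψ)).re =
      516 * (3 - (inner ℂ ψ (biasOperator m ζ a0 a1 b0 b1 ψ)).re) := by
    have hc : inner ℂ ψ ((U' + ζ' • V') ψ) = star (inner ℂ ψ ((U + ζ • V) ψ)) := by
      have h3 := inner_star_mul sK 1 ψ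
      rw [mul_one] at h3
      rw [h3]
      exact (inner_conj_symm ψ ((U' + ζ' • V') ψ)).symm
    have hp : inner ℂ ψ ψ = (1 : ℂ) := by rw [inner_self_eq_norm_sq_to_K, hψ]; simp
    have hr : ∀ x : ℂ, (star x).re = x.re := fun x => Complex.conj_re x
    rw [LinearMap.smul_apply, LinearMap.sub_apply, LinearMap.sub_apply, LinearMap.smul_apply,
      Module.End.one_apply, inner_smul_right, inner_sub_right, inner_sub_right, inner_smul_right,
      hp, hc, hK, show (258 : ℂ) = ((258 : ℝ) : ℂ) by norm_num, Complex.re_ofReal_mul,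
      Complex.sub_re, Complex.sub_re, hr]
    generalize (inner ℂ ψ ((U + ζ • V) ψ)).re = w
    norm_num
    ring
  rw [← hL, key]
  generalize (5 * ζ - 1) • U + (ζ - 5) • V + (5 * ζ' - 1) • U' + (ζ' - 5) • V' = Rb at sRb ⊢
  simp only [LinearMap.add_apply _ _ ψ, LinearMap.smul_apply _ _ ψ, inner_add_right,
    inner_smul_right]
  rw [inner_star_mul sRa, inner_star_mul sRb, inner_star_mul sS, inner_star_mul sS',
    inner_star_mul sT1, inner_star_mul sT1', inner_star_mul sT2, inner_star_mul sT2',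
    inner_star_mul sT1', inner_star_mul sT1, inner_star_mul sT2', inner_star_mul sT2]
  have hre : ∀ (r : ℝ) (w : ℂ), ((r : ℂ) * w).re = r * w.re := Complex.re_ofReal_mul
  have e3 := hre 3
  have e15 := hre 15
  have e21 := hre 21
  have e42 := hre 42
  push_cast at e3 e15 e21 e42
  obtain ⟨n1, n2, n3, n4⟩ := norm_le_five_of_sq h0 h1 h2
  have g1 := re_mul_inner_ge (T2' ψ) (T2 ψ) n1
  have g2 := re_mul_inner_ge (T2 ψ) (T2' ψ) n2
  have g3 := re_mul_inner_ge (T1' ψ) (T1 ψ) n3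
  have g4 := re_mul_inner_ge (T1 ψ) (T1' ψ) n4
  simp only [Complex.add_re, mul_assoc, e3, e15, e21, e42, re_inner_self]
  -- The cross terms cost at most 2·3·5·‖Tψ‖‖T†ψ‖ ≤ 15(‖Tψ‖² + ‖T†ψ‖²) for each T, which leaves 42 -
  -- 15 = 27.
  nlinarith [sq_nonneg (‖T1 ψ‖ - ‖T1' ψ‖), sq_nonneg (‖T2 ψ‖ - ‖T2' ψ‖)]

theorem re_inner_biasOperator_le (hm : IsTensorAction m) (ha : IsCubicPair a0 a1)
    (hb : IsCubicPair b0 b1) {ζ : ℂ} (h1 : star ζ = 1 - ζ) (h2 : ζ ^ 2 = ζ - 1) {ψ : H}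
    (hψ : ‖ψ‖ = 1) : (inner ℂ ψ (biasOperator m ζ a0 a1 b0 b1 ψ)).re ≤ 3 := by
  have h := sum_of_squares_le hm ha hb h1 rfl h2 hψ rfl rfl rfl rfl rfl rfl rfl rfl
  have h3 := (by positivity : (0 : ℝ) ≤ _).trans h
  linarith

end OptimalState

/-! ### Relations forced on an optimal state. -/

section MaximalState

variable {RA RB H : Type*} [Ring RA] [StarRing RA] [Ring RB] [StarRing RB]
  [NormedAddCommGroup H] [InnerProductSpace ℂ H]

/-- The relations satisfied by a state `ψ` attaining the maximal bias. -/
structure IsMaximalState (m : RA → RB → Module.End ℂ H) (a0 a1 : RA) (b0 b1 : RB) (ζ : ℂ)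
    (ψ : H) : Prop where
  left_eq : m (a1 * star a0) 1 ψ = m 1 (star b0 * b1) ψ
  left_eq' : m (star a0 * a1) 1 ψ = m 1 (b1 * star b0) ψ
  left_star : m (a0 * star a1) 1 ψ = m (a1 * star a0) 1 ψ
  right_star : m 1 (star b1 * b0) ψ = m 1 (star b0 * b1) ψ
  sub_eq : m a0 (star b0) ψ - m a1 (star b0) ψ = ζ • (ψ - m (a1 * star a0) 1 ψ)
  sub_eq' : m (star a0) b0 ψ - m (star a1) b0 ψ = (1 - ζ) • (ψ - m (star a0 * a1) 1 ψ)
  add_eq : (2 * (1 + ζ)) • (m a0 (star b0) ψ + m a1 (star b0) ψ) =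
    (4 : ℂ) • ψ + (3 : ℂ) • m (a1 * star a0) 1 ψ - m (star a0 * a1) 1 ψ
  add_eq' : (2 * (2 - ζ)) • (m (star a0) b0 ψ + m (star a1) b0 ψ) =
    (4 : ℂ) • ψ - m (a1 * star a0) 1 ψ + (3 : ℂ) • m (star a0 * a1) 1 ψ
  left_mul : m (a1 * star a0 * (star a0 * a1)) 1 ψ =
    m (a1 * star a0) 1 ψ + m (star a0 * a1) 1 ψ - ψ

theorem eq_zero_of_weighted_sq_le {p q r s t u v w : ℝ}
    (h : 21 * p ^ 2 + q ^ 2 + 15 * r ^ 2 + 15 * s ^ 2 + 27 * (t ^ 2 + u ^ 2 + v ^ 2 + w ^ 2) ≤ 0) :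
    (p = 0 ∧ q = 0 ∧ r = 0 ∧ s = 0) ∧ t = 0 ∧ u = 0 ∧ v = 0 ∧ w = 0 := by
  have := sq_nonneg p
  have := sq_nonneg q
  have := sq_nonneg r
  have := sq_nonneg s
  have := sq_nonneg t
  have := sq_nonneg u
  have := sq_nonneg v
  have := sq_nonneg w
  refine ⟨⟨?_, ?_, ?_, ?_⟩, ?_, ?_, ?_, ?_⟩ <;> refine pow_eq_zero_iff two_ne_zero |>.1 ?_ <;>
    linarith

variable [Algebra ℂ RA] [Algebra ℂ RB] [FiniteDimensional ℂ H] {m : RA → RB → Module.End ℂ H} {a0 a1 : RA} {b0 b1 : RB}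

/-- Equality in the bound makes all eight vectors in `sum_of_squares_le` vanish. The four
T-relations compare D and E with Bob's operators; the other four are linear equations for a₀b₀†ψ,
a₁b₀†ψ, a₀†b₀ψ and a₁†b₀ψ. -/
theorem isMaximalState_of_inner_eq (hm : IsTensorAction m) (ha : IsCubicPair a0 a1)
    (hb : IsCubicPair b0 b1) {ζ : ℂ} (h1 : star ζ = 1 - ζ) (h2 : ζ ^ 2 = ζ - 1) {ψ : H}
    (hψ : ‖ψ‖ = 1) (hK : (inner ℂ ψ (biasOperator m ζ a0 a1 b0 b1 ψ)).re = 3) :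
    IsMaximalState m a0 a1 b0 b1 ζ ψ := by
  have h := sum_of_squares_le hm ha hb h1 rfl h2 hψ rfl rfl rfl rfl rfl rfl rfl rfl
  rw [hK, sub_self, mul_zero] at h
  obtain ⟨⟨hRa, hRb, hS, hS'⟩, hT1, hT1', hT2, hT2'⟩ := eq_zero_of_weighted_sq_le h
  rw [norm_eq_zero] at hRa hRb hS hS' hT1 hT1' hT2 hT2'
  simp only [LinearMap.add_apply, LinearMap.sub_apply, LinearMap.smul_apply,
    Module.End.one_apply] at hRa hRb hS hS' hT1 hT1' hT2 hT2'
  have cross := sub_eq_zero.1 hT1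
  have swap := sub_eq_zero.1 hT1'
  have diag := sub_eq_zero.1 hT2
  have diag' := sub_eq_zero.1 hT2'
  -- Applying a product unitary to a T-relation cancels one factor on each side, leaving an operator
  -- of Alice alone equal to one of Bob alone.
  have D1 : m (a1 * star a0) 1 ψ = m 1 (star b1 * b0) ψ := by
    have := congrArg (m a1 (star b1)) swap
    simp only [hm.apply, hb.star_v_mul, ha.v_mul_star] at this
    exact this
  have D2 : m (a1 * star a0) 1 ψ = m 1 (star b0 * b1) ψ := by
    have := congrArg (m a1 (star b0)) diag'
    simp only [hm.apply, hb.star_u_mul, ha.v_mul_star] at this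
    exact this
  have D3 : m (a0 * star a1) 1 ψ = m 1 (star b0 * b1) ψ := by
    have := congrArg (m a0 (star b0)) swap
    simp only [hm.apply, hb.star_u_mul, ha.u_mul_star] at this
    exact this.symm
  have E1 : m (star a0 * a1) 1 ψ = m 1 (b1 * star b0) ψ := by
    have := congrArg (m (star a0) b1) diag
    simp only [hm.apply, hb.v_mul_star, ha.star_u_mul] at this
    exact this.symm
  have E2 : m (star a1 * a0) 1 ψ = m 1 (b1 * star b0) ψ := by
    have := congrArg (m (star a1) b1) cross
    simp only [hm.apply, hb.v_mul_star, ha.star_v_mul] at this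
    exact this
  have E3 : m (star a0 * a1) 1 ψ = m 1 (b0 * star b1) ψ := by
    have := congrArg (m (star a0) b0) cross
    simp only [hm.apply, hb.u_mul_star, ha.star_u_mul] at this
    exact this.symm
  have sub_eq : m a0 (star b0) ψ - m a1 (star b0) ψ = ζ • (ψ - m (a1 * star a0) 1 ψ) := by
    have := congrArg (m 1 (star b0)) hS
    simp only [map_sub, map_smul, hm.apply, one_mul, mul_one, hb.star_u_mul, hm.one, ← D2,
      Module.End.one_apply, map_zero] at this
    exact sub_eq_zero.1 this
  have sub_eq' : m (star a0) b0 ψ - m (star a1) b0 ψ =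
      (1 - ζ) • (ψ - m (star a0 * a1) 1 ψ) := by
    have := congrArg (m 1 b0) hS'
    simp only [map_sub, map_smul, hm.apply, one_mul, mul_one, hb.u_mul_star, hm.one, ← E3,
      Module.End.one_apply, map_zero] at this
    rw [← sub_eq_zero.1 this, smul_smul, show (1 - ζ) * ζ = 1 by linear_combination -h2, one_smul]
  rw [← diag, ← diag', cross, swap] at hRa hRb
  have hz3 : ζ ^ 3 = -1 := by linear_combination (ζ + 1) * h2
  have add_eq : (2 * (1 + ζ)) • (m a0 (star b0) ψ + m a1 (star b0) ψ) =
      (4 : ℂ) • ψ + (3 : ℂ) • m (a1 * star a0) 1 ψ - m (star a0 * a1) 1 ψ := by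
    -- The weight (2ζ - 1)/6 cancels a₀†b₀ψ + a₁†b₀ψ between the two equations; the multiples of
    -- `sub_eq` and `sub_eq'` eliminate the differences. The opposite weight in `add_eq'` cancels
    -- the other sum.
    linear_combination (norm := skip) (-1 : ℂ) • hRa - ((2 * ζ - 1) / 6) • hRb +
      (2 * (2 * ζ - 1) * (ζ + 1) / 3 - (1 - ζ)) • sub_eq +
      (2 * (2 * ζ - 1) * (2 - ζ) / 3 - ζ) • sub_eq'
    match_scalars <;> ring_nf <;> simp only [h2, hz3] <;> ring_nf
  have add_eq' : (2 * (2 - ζ)) • (m (star a0) b0 ψ + m (star a1) b0 ψ) =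
      (4 : ℂ) • ψ - m (a1 * star a0) 1 ψ + (3 : ℂ) • m (star a0 * a1) 1 ψ := by
    linear_combination (norm := skip) (-1 : ℂ) • hRa - ((2 * (1 - ζ) - 1) / 6) • hRb +
      (2 * (1 - 2 * ζ) * (ζ + 1) / 3 - (1 - ζ)) • sub_eq +
      (2 * (1 - 2 * ζ) * (2 - ζ) / 3 - ζ) • sub_eq'
    match_scalars <;> ring_nf <;> simp only [h2, hz3] <;> ring_nf
  refine ⟨D2, E1, D3.trans D2.symm, D1.symm.trans D2, sub_eq, sub_eq', add_eq, add_eq', ?_⟩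
  -- D exchanges a₀b₀†ψ and a₁b₀†ψ, hence fixes their sum: applying D to `add_eq` and subtracting
  -- yields the formula for DEψ.
  have hc0 : m (a1 * star a0) 1 (m a0 (star b0) ψ) = m a1 (star b0) ψ := by
    rw [hm.apply, mul_assoc, ha.star_u_mul, mul_one, one_mul]
  have hc1 : m (a1 * star a0) 1 (m a1 (star b0) ψ) = m a0 (star b0) ψ := by
    have := congrArg (m a1 (star b0)) (E1.trans E2.symm)
    rw [hm.apply, hm.apply, ← mul_assoc a1 (star a1), ha.v_mul_star, one_mul, mul_one] at this
    rw [hm.apply, one_mul, mul_assoc, this]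
  have hDD : m (a1 * star a0) 1 (m (a1 * star a0) 1 ψ) = ψ := by
    rw [← D3.trans D2.symm, hm.apply, mul_assoc, ← mul_assoc (star a0), ha.star_u_mul, one_mul,
      ha.v_mul_star, one_mul, hm.one, Module.End.one_apply]
  have h3 := congrArg (m (a1 * star a0) 1) add_eq
  simp only [map_sub, map_add, map_smul] at h3
  rw [hc0, hc1, hDD, hm.apply, one_mul] at h3
  linear_combination (norm := module) h3 - add_eq

namespace IsMaximalState

variable {ζ : ℂ} {ψ : H}

/-- Solving `add_eq` and `sub_eq` expresses a₀b₀†ψ through ψ, Dψ and Eψ, and the last two are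
operators of Bob on ψ. This is what makes Alice's support invariant under a₀. -/
theorem exists_left_eq_right (h : IsMaximalState m a0 a1 b0 b1 ζ ψ) (hm : IsTensorAction m)
    (hb : IsCubicPair b0 b1) (h2 : ζ ^ 2 = ζ - 1) : ∃ y, m a0 1 ψ = m 1 y ψ := by
  -- Since (1 + ζ)(2 - ζ) = 3, the scalar (2 - ζ)/12 is 1/(4(1 + ζ)).
  refine ⟨((2 - ζ) / 12) • (b0 * ((4 : ℂ) • 1 + (3 : ℂ) • (star b0 * b1) - b1 * star b0)) +
    (ζ / 2) • (b0 * (1 - star b0 * b1)), ?_⟩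
  have hc : m a0 (star b0) ψ = ((2 - ζ) / 12) • ((4 : ℂ) • ψ + (3 : ℂ) • m (a1 * star a0) 1 ψ -
      m (star a0 * a1) 1 ψ) + (ζ / 2) • (ψ - m (a1 * star a0) 1 ψ) := by
    linear_combination (norm := skip) ((2 - ζ) / 12) • h.add_eq + (1 / 2 : ℂ) • h.sub_eq
    match_scalars <;> ring_nf <;> simp only [h2] <;> ring_nf
  have h3 : m a0 1 ψ = m 1 b0 (m a0 (star b0) ψ) := by
    rw [hm.apply, one_mul, hb.u_mul_star]
  rw [h3, hc, h.left_eq, h.left_eq']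
  simp only [map_add, map_sub, map_smul, hm.apply, hm.add_right, hm.sub_right, hm.smul_right,
    mul_add, mul_sub, mul_smul_comm, mul_one, LinearMap.add_apply, LinearMap.sub_apply,
    LinearMap.smul_apply]

theorem exists_right_eq_left (h : IsMaximalState m a0 a1 b0 b1 ζ ψ) (hm : IsTensorAction m)
    (ha : IsCubicPair a0 a1) (h2 : ζ ^ 2 = ζ - 1) : ∃ x, m 1 b0 ψ = m x 1 ψ := by
  refine ⟨((1 + ζ) / 12) • (a0 * ((4 : ℂ) • 1 - a1 * star a0 + (3 : ℂ) • (star a0 * a1))) +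
    ((1 - ζ) / 2) • (a0 * (1 - star a0 * a1)), ?_⟩
  have hc : m (star a0) b0 ψ = ((1 + ζ) / 12) • ((4 : ℂ) • ψ - m (a1 * star a0) 1 ψ +
      (3 : ℂ) • m (star a0 * a1) 1 ψ) + ((1 - ζ) / 2) • (ψ - m (star a0 * a1) 1 ψ) := by
    linear_combination (norm := skip) ((1 + ζ) / 12) • h.add_eq' + (1 / 2 : ℂ) • h.sub_eq'
    match_scalars <;> ring_nf <;> simp only [h2] <;> ring_nf
  have h3 : m 1 b0 ψ = m a0 1 (m (star a0) b0 ψ) := by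
    rw [hm.apply, one_mul, ha.u_mul_star]
  rw [h3, hc]
  simp only [map_add, map_sub, map_smul, hm.apply, hm.add_left, hm.sub_left, hm.smul_left,
    mul_add, mul_sub, mul_smul_comm, mul_one, LinearMap.add_apply, LinearMap.sub_apply,
    LinearMap.smul_apply]

theorem left_sq (h : IsMaximalState m a0 a1 b0 b1 ζ ψ) (hm : IsTensorAction m)
    (ha : IsCubicPair a0 a1) : m (a1 * star a0 * (a1 * star a0)) 1 ψ = ψ := by
  have := congrArg (m (a1 * star a0) 1) h.left_star
  rw [hm.apply, hm.apply, one_mul, mul_assoc, ← mul_assoc (star a0), ha.star_u_mul, one_mul,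
    ha.v_mul_star, hm.one] at this
  exact this.symm

theorem right_sq (h : IsMaximalState m a0 a1 b0 b1 ζ ψ) (hm : IsTensorAction m)
    (hb : IsCubicPair b0 b1) : m 1 (star b0 * b1 * (star b0 * b1)) ψ = ψ := by
  have := congrArg (m 1 (star b0 * b1)) h.right_star
  rw [hm.apply, hm.apply, one_mul, mul_assoc, ← mul_assoc b1, hb.v_mul_star, one_mul,
    hb.star_u_mul, hm.one] at this
  exact this.symm

/-- Operators of different players commute, so b₁b₀†·b₀†b₁ acts on ψ as DE does, and `left_mul`
transfers to Bob. -/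
theorem right_mul (h : IsMaximalState m a0 a1 b0 b1 ζ ψ) (hm : IsTensorAction m) :
    m 1 (b1 * star b0 * (star b0 * b1)) ψ =
      m 1 (b1 * star b0) ψ + m 1 (star b0 * b1) ψ - ψ := by
  have h1 : m 1 (b1 * star b0 * (star b0 * b1)) ψ =
      m 1 (b1 * star b0) (m 1 (star b0 * b1) ψ) := by rw [hm.apply, one_mul]
  rw [h1, ← h.left_eq, hm.apply, one_mul, mul_one]
  have h2 : m (a1 * star a0) (b1 * star b0) ψ =
      m (a1 * star a0) 1 (m 1 (b1 * star b0) ψ) := by rw [hm.apply, one_mul, mul_one]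
  rw [h2, ← h.left_eq', hm.apply, one_mul, h.left_mul, add_comm]

end IsMaximalState

end MaximalState

/-! ### Three conjugate involutions and the isometry into ℂ³ ⊗ J. -/

section ReflectionTriple

variable {H : Type*} [NormedAddCommGroup H] [InnerProductSpace ℂ H] [FiniteDimensional ℂ H]

/-- A unitary `u` of order three and a unitary `D` preserving `W` such that, on `W`, `D` is an
involution and `(1 - D)(1 - u†Du) = 0`. -/
structure IsReflectionTriple (u D : Module.End ℂ H) (W : Submodule ℂ H) : Prop where
  star_u_mul : star u * u = 1
  u_mul_star : u * star u = 1
  u_sq : u * u = star u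
  star_D_mul : star D * D = 1
  prod : D * (u * D * star u) * (star u * D * u) = -1
  u_mem : ∀ w ∈ W, u w ∈ W
  D_mem : ∀ w ∈ W, D w ∈ W
  D_sq : ∀ w ∈ W, D (D w) = w
  mul_eq : ∀ w ∈ W, D (star u (D (u w))) = D w + star u (D (u w)) - w

/-- The projection `(1 - D) / 2` onto the `-1`-eigenspace of an involution `D`. -/
noncomputable def negProj (D : Module.End ℂ H) : Module.End ℂ H := (2⁻¹ : ℂ) • (1 - D)

theorem negProj_apply (D : Module.End ℂ H) (x : H) : negProj D x = (2⁻¹ : ℂ) • (x - D x) := rfl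

theorem norm_apply_of_star_mul {D : Module.End ℂ H} (hD : star D * D = 1) (x : H) :
    ‖D x‖ = ‖x‖ := by
  have h1 := inner_star_mul rfl D x (X := D)
  rw [hD, Module.End.one_apply] at h1
  have h2 := congrArg Complex.re h1
  rw [re_inner_self, re_inner_self] at h2
  exact ((sq_eq_sq₀ (norm_nonneg _) (norm_nonneg _)).1 h2).symm

/-- Only unitarity enters: ‖x - Dx‖² = 2‖x‖² - 2 Re⟨x, Dx⟩. -/
theorem norm_negProj_sq {D : Module.End ℂ H} (hD : star D * D = 1) (x : H) :
    ‖negProj D x‖ ^ 2 = (‖x‖ ^ 2 - (inner ℂ x (D x)).re) / 2 := by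
  have h := norm_sub_sq (𝕜 := ℂ) x (D x)
  rw [norm_apply_of_star_mul hD] at h
  rw [negProj_apply, norm_smul, mul_pow, h]
  simp
  ring

namespace IsReflectionTriple

variable {u D : Module.End ℂ H} {W : Submodule ℂ H}

theorem star_u_mul_apply (h : IsReflectionTriple u D W) (x : H) : star u (u x) = x := by
  rw [← Module.End.mul_apply, h.star_u_mul, Module.End.one_apply]

theorem u_mul_star_apply (h : IsReflectionTriple u D W) (x : H) : u (star u x) = x := by
  rw [← Module.End.mul_apply, h.u_mul_star, Module.End.one_apply]

theorem u_sq_apply (h : IsReflectionTriple u D W) (x : H) : u (u x) = star u x := by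
  rw [← Module.End.mul_apply, h.u_sq]

theorem star_u_sq_apply (h : IsReflectionTriple u D W) (x : H) : star u (star u x) = u x := by
  rw [← h.u_sq_apply, h.u_mul_star_apply]

theorem star_u_mem (h : IsReflectionTriple u D W) {w : H} (hw : w ∈ W) : star u w ∈ W := by
  rw [← h.u_sq_apply]
  exact h.u_mem _ (h.u_mem _ hw)

theorem add_eq (h : IsReflectionTriple u D W) {w : H} (hw : w ∈ W) :
    D w + u (D (star u w)) + star u (D (u w)) = w := by
  have h1 : star u (D (u w)) ∈ W := h.star_u_mem (h.D_mem _ (h.u_mem _ hw))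
  -- With G = uDu† and E = u†Du, evaluating DGE = -1 at Ew and using E² = 1 gives DGw = -Ew. Thus Gw
  -- = -DEw, which `mul_eq` turns into w - Dw - Ew.
  have h2 := congrArg (fun X : Module.End ℂ H => X (star u (D (u w)))) h.prod
  simp only [Module.End.mul_apply, h.u_mul_star_apply, h.D_sq _ (h.u_mem _ hw),
    h.star_u_mul_apply] at h2
  have h3 := congrArg D h2
  rw [h.D_sq _ (h.u_mem _ (h.D_mem _ (h.star_u_mem hw)))] at h3
  simp only [LinearMap.neg_apply, Module.End.one_apply, map_neg, h.mul_eq _ hw] at h3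
  rw [h3]
  abel

theorem negProj_D (h : IsReflectionTriple u D W) {w : H} (hw : w ∈ W) :
    negProj D (D w) = -negProj D w := by
  rw [negProj_apply, negProj_apply, h.D_sq w hw]
  module

theorem negProj_star_u_D (h : IsReflectionTriple u D W) {w : H} (hw : w ∈ W) :
    negProj D (star u (D w)) = negProj D (star u w) := by
  have h1 := h.mul_eq _ (h.star_u_mem hw)
  rw [h.u_mul_star_apply] at h1
  rw [negProj_apply, negProj_apply, h1]
  module

/-- With G and E the conjugates uDu† and u†Du, `add_eq` gives 1 - G = D + E on W, and (1 - D)(D + E)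
= D + E - 1 - DE = 0 by `mul_eq`. -/
theorem negProj_u_D (h : IsReflectionTriple u D W) {w : H} (hw : w ∈ W) :
    negProj D (u (D w)) = negProj D (u w) := by
  have h0 := h.u_mem _ hw
  have h1 := h.add_eq h0
  have h2 := congrArg D h1
  have h3 := h.mul_eq _ h0
  rw [h.star_u_mul_apply] at h1 h2
  simp only [map_add, h.D_sq _ h0, h3] at h2
  rw [negProj_apply, negProj_apply]
  linear_combination (norm := module) (2⁻¹ : ℂ) • h1 - (2⁻¹ : ℂ) • h2

/-- The three conjugates of D add up to the identity on W, so the three halves of ‖w‖² - Re⟨w, ·w⟩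
add up to (3 - 1)‖w‖²/2. -/
theorem norm_sq_eq (h : IsReflectionTriple u D W) {w : H} (hw : w ∈ W) :
    ‖negProj D w‖ ^ 2 + ‖negProj D (star u w)‖ ^ 2 + ‖negProj D (u w)‖ ^ 2 = ‖w‖ ^ 2 := by
  have hs : star (star u) * star u = 1 := by rw [star_star, h.u_mul_star]
  have h1 : inner ℂ (star u w) (D (star u w)) = inner ℂ w (u (D (star u w))) :=
    (inner_star_mul rfl (D * star u) w (X := star u)).symm.trans (by rw [star_star]; rfl)
  have h2 : inner ℂ (u w) (D (u w)) = inner ℂ w (star u (D (u w))) :=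
    (inner_star_mul rfl (D * u) w (X := u)).symm
  have h3 := congrArg (fun x => (inner ℂ w x).re) (h.add_eq hw)
  simp only [inner_add_right, Complex.add_re, re_inner_self] at h3
  rw [norm_negProj_sq h.star_D_mul, norm_negProj_sq h.star_D_mul, norm_negProj_sq h.star_D_mul,
    norm_apply_of_star_mul h.star_u_mul, norm_apply_of_star_mul hs, h1, h2]
  linarith

end IsReflectionTriple

theorem norm_sq_add_add {x y z : H} (hxy : inner ℂ x y = (0 : ℂ)) (hxz : inner ℂ x z = (0 : ℂ))
    (hyz : inner ℂ y z = (0 : ℂ)) : ‖x + y + z‖ ^ 2 = ‖x‖ ^ 2 + ‖y‖ ^ 2 + ‖z‖ ^ 2 := by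
  rw [pow_two, norm_add_sq_eq_norm_sq_add_norm_sq_of_inner_eq_zero (𝕜 := ℂ) (x + y) z,
    norm_add_sq_eq_norm_sq_add_norm_sq_of_inner_eq_zero (𝕜 := ℂ) x y hxy]
  · ring
  · rw [inner_add_left, hxz, hyz, add_zero]

/-- The map `x ↦ |i⟩ ⊗ e x`. -/
noncomputable def ketTmul (i : Fin 3) : H →ₗᵢ[ℂ]
    EuclideanSpace ℂ (Fin 3) ⊗[ℂ] EuclideanSpace ℂ (Fin (Module.finrank ℂ H)) where
  toLinearMap := TensorProduct.mk ℂ _ _ (EuclideanSpace.single i 1) ∘ₗ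
    (stdOrthonormalBasis ℂ H).repr.toLinearEquiv.toLinearMap
  norm_map' x := by
    refine (TensorProduct.norm_tmul (𝕜 := ℂ) _ _).trans ?_
    simp

theorem inner_ketTmul {i j : Fin 3} (hij : i ≠ j) (x y : H) :
    inner ℂ (ketTmul i x) (ketTmul j y) = (0 : ℂ) := by
  refine (TensorProduct.inner_tmul (𝕜 := ℂ) _ _ _ _).trans ?_
  rw [EuclideanSpace.inner_single_left, PiLp.single_apply, if_neg hij, mul_zero, zero_mul]

namespace IsReflectionTriple

variable {u D : Module.End ℂ H} {W : Submodule ℂ H}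

theorem exists_isometry (h : IsReflectionTriple u D W) :
    ∃ V : H →ₗᵢ[ℂ] EuclideanSpace ℂ (Fin 3) ⊗[ℂ] EuclideanSpace ℂ (Fin (Module.finrank ℂ H)),
      ∀ w ∈ W, V w = ketTmul 0 (negProj D w) + ketTmul 1 (negProj D (star u w)) +
        ketTmul 2 (negProj D (u w)) := by
  let π : H →ₗ[ℂ] H := W.starProjection.toLinearMap
  have hπ : ∀ x, π x ∈ W := fun x => W.starProjection_apply_mem x
  have hπw : ∀ w ∈ W, π w = w := fun w hw => W.starProjection_eq_self_iff.2 hw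
  -- Vectors orthogonal to W are sent unchanged to the |0⟩ block. They stay orthogonal to the image
  -- of W there because `negProj D` maps W into W, so V is isometric on all of H.
  let V : H →ₗ[ℂ] EuclideanSpace ℂ (Fin 3) ⊗[ℂ] EuclideanSpace ℂ (Fin (Module.finrank ℂ H)) :=
    (ketTmul 0).toLinearMap ∘ₗ (negProj D ∘ₗ π + (LinearMap.id - π)) +
      (ketTmul 1).toLinearMap ∘ₗ (negProj D ∘ₗ star u ∘ₗ π) +
      (ketTmul 2).toLinearMap ∘ₗ (negProj D ∘ₗ u ∘ₗ π)
  have hV : ∀ x, V x = ketTmul 0 (negProj D (π x) + (x - π x)) +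
      ketTmul 1 (negProj D (star u (π x))) + ketTmul 2 (negProj D (u (π x))) := fun x => rfl
  refine ⟨⟨V, fun x => ?_⟩, fun w hw => ?_⟩
  · have horth : ∀ y ∈ W, inner ℂ y (x - π x) = (0 : ℂ) := fun y hy => by
      exact (W.mem_orthogonal _).1 (W.sub_starProjection_mem_orthogonal x) y hy
    have hn : negProj D (π x) ∈ W := W.smul_mem _ (W.sub_mem (hπ x) (h.D_mem _ (hπ x)))
    have h1 : ‖negProj D (π x) + (x - π x)‖ ^ 2 = ‖negProj D (π x)‖ ^ 2 + ‖x - π x‖ ^ 2 := by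
      rw [pow_two, pow_two, pow_two]
      exact norm_add_sq_eq_norm_sq_add_norm_sq_of_inner_eq_zero (𝕜 := ℂ) _ _ (horth _ hn)
    have h2 : ‖x‖ ^ 2 = ‖π x‖ ^ 2 + ‖x - π x‖ ^ 2 := by
      rw [pow_two, pow_two, pow_two]
      conv_lhs => rw [← add_sub_cancel (π x) x]
      exact norm_add_sq_eq_norm_sq_add_norm_sq_of_inner_eq_zero (𝕜 := ℂ) _ _ (horth _ (hπ x))
    have h3 : ‖V x‖ ^ 2 = ‖x‖ ^ 2 := by
      rw [hV]
      refine (norm_sq_add_add (inner_ketTmul (by decide) _ _) (inner_ketTmul (by decide) _ _)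
        (inner_ketTmul (by decide) _ _)).trans ?_
      rw [LinearIsometry.norm_map, LinearIsometry.norm_map, LinearIsometry.norm_map, h1, h2,
        ← h.norm_sq_eq (hπ x)]
      ring
    exact (sq_eq_sq₀ (norm_nonneg _) (norm_nonneg _)).1 h3
  · refine (hV w).trans ?_
    rw [hπw w hw, sub_self, add_zero]

end IsReflectionTriple

end ReflectionTriple

/-! ### Local supports of a bipartite state. -/

section Support

open TensorProduct

variable {HA HB : Type*} [AddCommGroup HA] [Module ℂ HA] [AddCommGroup HB] [Module ℂ HB]

/-- The contractions `(1 ⊗ f) ψ` of a tensor with the functionals on the second factor. -/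
def leftSupport (ψ : HA ⊗[ℂ] HB) : Submodule ℂ HA :=
  LinearMap.range ((TensorProduct.rid ℂ HA).toLinearMap ∘ₗ LinearMap.applyₗ ψ ∘ₗ
    LinearMap.lTensorHom (R := ℂ) (N := HB) (P := ℂ) HA)

theorem mem_leftSupport {ψ : HA ⊗[ℂ] HB} {w : HA} :
    w ∈ leftSupport ψ ↔ ∃ f : HB →ₗ[ℂ] ℂ, TensorProduct.rid ℂ HA (map LinearMap.id f ψ) = w :=
  Iff.rfl

theorem rid_map_map (x : HA →ₗ[ℂ] HA) (y : HB →ₗ[ℂ] HB) (f : HB →ₗ[ℂ] ℂ) (ψ : HA ⊗[ℂ] HB) :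
    TensorProduct.rid ℂ HA (map LinearMap.id f (map x y ψ)) =
      x (TensorProduct.rid ℂ HA (map LinearMap.id (f ∘ₗ y) ψ)) := by
  induction ψ with
  | zero => simp
  | tmul a b => simp
  | add a b ha hb => simp only [map_add, ha, hb]

/-- Contracting (x ⊗ 1)ψ = (1 ⊗ y)ψ with f shows that x maps the contraction by f to the contraction
by f ∘ y. -/
theorem apply_mem_leftSupport {ψ : HA ⊗[ℂ] HB} {x : Module.End ℂ HA} {y : Module.End ℂ HB}
    (h : map x 1 ψ = map 1 y ψ) {w : HA} (hw : w ∈ leftSupport ψ) : x w ∈ leftSupport ψ := by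
  obtain ⟨f, rfl⟩ := mem_leftSupport.1 hw
  refine mem_leftSupport.2 ⟨f ∘ₗ y, ?_⟩
  have h1 := rid_map_map x 1 f ψ
  rw [h, rid_map_map] at h1
  exact h1

theorem apply_eq_of_mem_leftSupport {ψ : HA ⊗[ℂ] HB} {x x' : Module.End ℂ HA}
    (h : map x (1 : Module.End ℂ HB) ψ = map x' 1 ψ) {w : HA} (hw : w ∈ leftSupport ψ) :
    x w = x' w := by
  obtain ⟨f, rfl⟩ := mem_leftSupport.1 hw
  have h1 := rid_map_map x 1 f ψ
  rw [h, rid_map_map] at h1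
  exact h1.symm

/-- Expanding the second factor in a basis puts every first-factor coefficient of ψ in `leftSupport
ψ`. -/
theorem map_eq_of_eqOn_leftSupport {NA NB : Type*} [AddCommGroup NA] [Module ℂ NA]
    [AddCommGroup NB] [Module ℂ NB] [FiniteDimensional ℂ HB] {ψ : HA ⊗[ℂ] HB}
    {f g : HA →ₗ[ℂ] NA} (h : ∀ w ∈ leftSupport ψ, f w = g w) (y : HB →ₗ[ℂ] NB) :
    map f y ψ = map g y ψ := by
  let b := Module.finBasis ℂ HB
  have hψ : ∀ φ : HA ⊗[ℂ] HB,
      φ = ∑ i, TensorProduct.rid ℂ HA (map LinearMap.id (b.coord i) φ) ⊗ₜ[ℂ] b i := by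
    intro φ
    induction φ with
    | zero => simp
    | tmul x z =>
      simp only [map_tmul, LinearMap.id_apply, rid_tmul, smul_tmul, ← tmul_sum]
      rw [show ∑ i, b.coord i z • b i = z from b.sum_repr z]
    | add x z hx hz =>
      simp only [map_add, add_tmul, Finset.sum_add_distrib]
      rw [← hx, ← hz]
  rw [hψ ψ]
  simp only [map_sum, map_tmul]
  exact Finset.sum_congr rfl fun i _ => by rw [h _ (mem_leftSupport.2 ⟨_, rfl⟩)]

/-- The contractions `(f ⊗ 1) ψ` of a tensor with the functionals on the first factor. -/
def rightSupport (ψ : HA ⊗[ℂ] HB) : Submodule ℂ HB :=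
  leftSupport (TensorProduct.comm ℂ HA HB ψ)

theorem apply_mem_rightSupport {ψ : HA ⊗[ℂ] HB} {x : Module.End ℂ HA} {y : Module.End ℂ HB}
    (h : map 1 y ψ = map x 1 ψ) {w : HB} (hw : w ∈ rightSupport ψ) : y w ∈ rightSupport ψ := by
  refine apply_mem_leftSupport (y := x) ?_ hw
  rw [map_comm, map_comm, h]

theorem apply_eq_of_mem_rightSupport {ψ : HA ⊗[ℂ] HB} {y y' : Module.End ℂ HB}
    (h : map (1 : Module.End ℂ HA) y ψ = map 1 y' ψ) {w : HB} (hw : w ∈ rightSupport ψ) :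
    y w = y' w := by
  refine apply_eq_of_mem_leftSupport ?_ hw
  rw [map_comm, map_comm, h]

theorem map_eq_of_eqOn_rightSupport {NA NB : Type*} [AddCommGroup NA] [Module ℂ NA]
    [AddCommGroup NB] [Module ℂ NB] [FiniteDimensional ℂ HA] {ψ : HA ⊗[ℂ] HB}
    {f g : HB →ₗ[ℂ] NB} (h : ∀ w ∈ rightSupport ψ, f w = g w) (x : HA →ₗ[ℂ] NA) :
    map x f ψ = map x g ψ := by
  have h1 := map_eq_of_eqOn_leftSupport h x
  rw [map_comm, map_comm] at h1
  exact (TensorProduct.comm ℂ NA NB).injective h1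

end Support

/-! ### Each player's reflection triple on the support. -/

section Concrete

open TensorProduct

variable {HA HB : Type*} [NormedAddCommGroup HA] [InnerProductSpace ℂ HA] [FiniteDimensional ℂ HA]
  [NormedAddCommGroup HB] [InnerProductSpace ℂ HB] [FiniteDimensional ℂ HB]

/-- The operator `x ⊗ y`. -/
def tensorOp (x : Module.End ℂ HA) (y : Module.End ℂ HB) : Module.End ℂ (HA ⊗[ℂ] HB) := map x y

theorem isTensorAction_tensorOp : IsTensorAction (tensorOp (HA := HA) (HB := HB)) where
  mul x x' y y' := (TensorProduct.map_mul x x' y y').symm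
  one := TensorProduct.map_one
  add_left x x' y := map_add_left x x' y
  add_right x y y' := map_add_right x y y'
  smul_left c x y := map_smul_left c x y
  smul_right c x y := map_smul_right c x y
  star x y := TensorProduct.adjoint_map x y

variable {a0 a1 : Module.End ℂ HA} {b0 b1 : Module.End ℂ HB} {ζ : ℂ} {ψ : HA ⊗[ℂ] HB}

namespace IsMaximalState

theorem isReflectionTriple_left (h : IsMaximalState tensorOp a0 a1 b0 b1 ζ ψ)
    (ha : IsCubicPair a0 a1) (hb : IsCubicPair b0 b1) (h2 : ζ ^ 2 = ζ - 1) :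
    IsReflectionTriple a0 (a1 * star a0) (leftSupport ψ) where
  star_u_mul := ha.star_u_mul
  u_mul_star := ha.u_mul_star
  u_sq := ha.u_sq
  star_D_mul := by
    rw [star_mul, star_star, mul_assoc, ← mul_assoc (star a1), ha.star_v_mul, one_mul,
      ha.u_mul_star]
  prod := by
    have h1 : a1 * star a0 * (a0 * (a1 * star a0) * star a0) * (star a0 * (a1 * star a0) * a0) =
        a1 * (star a0 * a0) * a1 * (star a0 * star a0 * star a0) * a1 * (star a0 * a0) := by
      noncomm_ring
    rw [h1, ha.star_u_mul, ha.star_u_sq, ha.u_mul_star, mul_one, mul_one, mul_one, ha.v_sq,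
      neg_mul, ha.star_v_mul]
  u_mem w hw := by
    obtain ⟨y, hy⟩ := h.exists_left_eq_right isTensorAction_tensorOp hb h2
    exact apply_mem_leftSupport hy hw
  D_mem w hw := apply_mem_leftSupport h.left_eq hw
  D_sq w hw := by
    have h1 := h.left_sq isTensorAction_tensorOp ha
    refine apply_eq_of_mem_leftSupport (x := a1 * star a0 * (a1 * star a0)) (x' := 1) ?_ hw
    exact h1.trans (by rw [TensorProduct.map_one]; rfl)
  mul_eq w hw := by
    have h1 := h.left_mul
    have h3 : map (a1 * star a0 * (star a0 * a1)) (1 : Module.End ℂ HB) ψ =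
        map (a1 * star a0 + star a0 * a1 - 1) (1 : Module.End ℂ HB) ψ := by
      have hm := isTensorAction_tensorOp (HA := HA) (HB := HB)
      refine h1.trans ?_
      change _ = tensorOp _ _ ψ
      rw [hm.sub_left, hm.add_left, hm.one]
      rfl
    have h4 := apply_eq_of_mem_leftSupport h3 hw
    have h5 : star a0 ((a1 * star a0) (a0 w)) = (star a0 * a1 * (star a0 * a0)) w := rfl
    rw [ha.star_u_mul, mul_one] at h5
    rw [h5]
    exact h4

theorem isReflectionTriple_right (h : IsMaximalState tensorOp a0 a1 b0 b1 ζ ψ)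
    (ha : IsCubicPair a0 a1) (hb : IsCubicPair b0 b1) (h2 : ζ ^ 2 = ζ - 1) :
    IsReflectionTriple b0 (star b0 * b1) (rightSupport ψ) where
  star_u_mul := hb.star_u_mul
  u_mul_star := hb.u_mul_star
  u_sq := hb.u_sq
  star_D_mul := by
    rw [star_mul, star_star, mul_assoc, ← mul_assoc b0, hb.u_mul_star, one_mul, hb.star_v_mul]
  prod := by
    have h1 : star b0 * b1 * (b0 * (star b0 * b1) * star b0) * (star b0 * (star b0 * b1) * b0) =
        star b0 * b1 * (b0 * star b0) * b1 * (star b0 * star b0 * star b0) * b1 * b0 := by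
      noncomm_ring
    rw [h1, hb.u_mul_star, hb.star_u_sq, hb.u_mul_star, mul_one, mul_one, mul_assoc (star b0),
      hb.v_sq, mul_neg, neg_mul, neg_mul, mul_assoc (star b0), hb.star_v_mul, mul_one,
      hb.star_u_mul]
  u_mem w hw := by
    obtain ⟨y, hy⟩ := h.exists_right_eq_left isTensorAction_tensorOp ha h2
    exact apply_mem_rightSupport hy hw
  D_mem w hw := apply_mem_rightSupport h.left_eq.symm hw
  D_sq w hw := by
    have h1 := h.right_sq isTensorAction_tensorOp hb
    refine apply_eq_of_mem_rightSupport (y := star b0 * b1 * (star b0 * b1)) (y' := 1) ?_ hw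
    exact h1.trans (by rw [TensorProduct.map_one]; rfl)
  mul_eq w hw := by
    have h1 := h.right_mul isTensorAction_tensorOp
    have h3 : map (1 : Module.End ℂ HA) (b1 * star b0 * (star b0 * b1)) ψ =
        map (1 : Module.End ℂ HA) (b1 * star b0 + star b0 * b1 - 1) ψ := by
      have hm := isTensorAction_tensorOp (HA := HA) (HB := HB)
      refine h1.trans ?_
      change _ = tensorOp _ _ ψ
      rw [hm.sub_right, hm.add_right, hm.one]
      rfl
    -- The known relation involves b₁b₀† = b₀Fb₀† with F = b₀†b₁, on the left of F. Evaluating it at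
    -- b₀w and applying b₀† moves it to F·(b₀†Fb₀).
    obtain ⟨y, hy⟩ := h.exists_right_eq_left isTensorAction_tensorOp ha h2
    have h4 := congrArg (fun x => (star b0 : Module.End ℂ HB) x) (apply_eq_of_mem_rightSupport h3 (apply_mem_rightSupport hy hw))
    have hs : ∀ x, star b0 (b0 x) = x := fun x => by
      rw [← Module.End.mul_apply, hb.star_u_mul, Module.End.one_apply]
    simp only [Module.End.mul_apply, LinearMap.add_apply, LinearMap.sub_apply, map_add, map_sub,
      Module.End.one_apply, hs] at h4 ⊢
    exact h4

end IsMaximalState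

end Concrete

namespace IsReflectionTriple

variable {H : Type*} [NormedAddCommGroup H] [InnerProductSpace ℂ H] [FiniteDimensional ℂ H]
  {u D : Module.End ℂ H} {W : Submodule ℂ H}

theorem negProj_conj (h : IsReflectionTriple u D W) {w : H} (hw : w ∈ W) :
    negProj D (star u (D (u w))) = negProj D w := by
  rw [h.negProj_star_u_D (h.u_mem _ hw), h.star_u_mul_apply]

theorem negProj_star_u_conj (h : IsReflectionTriple u D W) {w : H} (hw : w ∈ W) :
    negProj D (star u (star u (D (u w)))) = negProj D (star u w) := by
  rw [h.star_u_sq_apply, h.negProj_u_D (h.u_mem _ hw), h.u_sq_apply]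

theorem negProj_u_conj (h : IsReflectionTriple u D W) {w : H} (hw : w ∈ W) :
    negProj D (u (star u (D (u w)))) = -negProj D (u w) := by
  rw [h.u_mul_star_apply, h.negProj_D (h.u_mem _ hw)]

theorem negProj_star_u_conj' (h : IsReflectionTriple u D W) {w : H} (hw : w ∈ W) :
    negProj D (star u (u (D (star u w)))) = -negProj D (star u w) := by
  rw [h.star_u_mul_apply, h.negProj_D (h.star_u_mem hw)]

theorem negProj_u_conj' (h : IsReflectionTriple u D W) {w : H} (hw : w ∈ W) :
    negProj D (u (u (D (star u w)))) = negProj D (u w) := by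
  rw [h.u_sq_apply, h.negProj_star_u_D (h.star_u_mem hw), h.star_u_sq_apply]

theorem star_D_apply (h : IsReflectionTriple u D W) {w : H} (hw : w ∈ W) : star D w = D w := by
  conv_lhs => rw [← h.D_sq w hw]
  rw [← Module.End.mul_apply, h.star_D_mul, Module.End.one_apply]

end IsReflectionTriple

/-! ### Components of the state in the two decompositions. -/

section Components

open TensorProduct

variable {HA HB : Type*} [AddCommGroup HA] [Module ℂ HA] [AddCommGroup HB] [Module ℂ HB]

theorem map_map_end (x x' : Module.End ℂ HA) (y y' : Module.End ℂ HB) (ψ : HA ⊗[ℂ] HB) :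
    map x y (map x' y' ψ) = map (x * x') (y * y') ψ := by
  rw [TensorProduct.map_mul, Module.End.mul_apply]

/-- Applying q ⊗ r to both sides of (D ⊗ 1)ψ = (1 ⊗ F)ψ scales the same vector by c and by c'. -/
theorem map_eq_zero_of_eigenvalues_ne [FiniteDimensional ℂ HA] [FiniteDimensional ℂ HB]
    {ψ : HA ⊗[ℂ] HB} {D q : Module.End ℂ HA} {F r : Module.End ℂ HB}
    (h : map D 1 ψ = map 1 F ψ) {c c' : ℂ} (hq : ∀ w ∈ leftSupport ψ, q (D w) = c • q w)
    (hr : ∀ w ∈ rightSupport ψ, r (F w) = c' • r w) (hc : c ≠ c') : map q r ψ = 0 := by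
  have h1 : map (q * D) r ψ = map (c • q) r ψ := map_eq_of_eqOn_leftSupport hq r
  have h2 : map q (r * F) ψ = map q (c' • r) ψ := map_eq_of_eqOn_rightSupport hr q
  have h3 := congrArg (map q r) h
  rw [map_map_end, map_map_end, mul_one, mul_one, h1, h2, map_smul_left, map_smul_right,
    LinearMap.smul_apply, LinearMap.smul_apply] at h3
  have h4 : (c - c') • map q r ψ = 0 := by rw [sub_smul, h3, sub_self]
  exact (smul_eq_zero.1 h4).resolve_left (sub_ne_zero.2 hc)

theorem map_sum_eq_of_components {NA NB : Type*} [AddCommGroup NA] [Module ℂ NA]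
    [AddCommGroup NB] [Module ℂ NB] {ψ : HA ⊗[ℂ] HB} {q0 q1 q2 : Module.End ℂ HA}
    {r0 r1 r2 : Module.End ℂ HB} {k0 k1 k2 : HA →ₗ[ℂ] NA} {l0 l1 l2 : HB →ₗ[ℂ] NB} {c d : ℂ}
    (h01 : map q0 r1 ψ = 0) (h02 : map q0 r2 ψ = 0) (h10 : map q1 r0 ψ = 0)
    (h11 : map q1 r1 ψ = 0) (h20 : map q2 r0 ψ = 0) (h22 : map q2 r2 ψ = 0)
    (h12 : map q1 r2 ψ = c • map q0 r0 ψ) (h21 : map q2 r1 ψ = d • map q0 r0 ψ) :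
    map (k0 ∘ₗ q0 + k1 ∘ₗ q1 + k2 ∘ₗ q2) (l0 ∘ₗ r0 + l1 ∘ₗ r1 + l2 ∘ₗ r2) ψ =
      map k0 l0 (map q0 r0 ψ) + c • map k1 l2 (map q0 r0 ψ) + d • map k2 l1 (map q0 r0 ψ) := by
  simp only [map_add_left, map_add_right, LinearMap.add_apply, map_comp, LinearMap.comp_apply,
    h01, h02, h10, h11, h20, h22, h12, h21, map_zero, map_smul]
  abel

end Components

namespace IsMaximalState

open TensorProduct

variable {HA HB : Type*} [NormedAddCommGroup HA] [InnerProductSpace ℂ HA] [FiniteDimensional ℂ HA]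
  [NormedAddCommGroup HB] [InnerProductSpace ℂ HB] [FiniteDimensional ℂ HB]
  {a0 a1 : Module.End ℂ HA} {b0 b1 : Module.End ℂ HB} {ζ : ℂ} {ψ : HA ⊗[ℂ] HB}

/-- On ψ, D matches F = b₀†b₁ and a₀†Da₀ matches b₀Fb₀†. For Alice's labels 0, 1, 2 the pair of
eigenvalues is (-1, 1), (1, 1), (1, -1); for Bob's it is (-1, 1), (1, -1), (1, 1). They agree only
at (0,0), (1,2) and (2,1). -/
theorem components (h : IsMaximalState tensorOp a0 a1 b0 b1 ζ ψ)
    (ha : IsCubicPair a0 a1) (hb : IsCubicPair b0 b1) (h2 : ζ ^ 2 = ζ - 1)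
    {p : Module.End ℂ HA} {q : Module.End ℂ HB} (hp : p = negProj (a1 * star a0))
    (hq : q = negProj (star b0 * b1)) :
    (map p (q * star b0) ψ = 0 ∧ map p (q * b0) ψ = 0 ∧ map (p * star a0) q ψ = 0 ∧
      map (p * star a0) (q * star b0) ψ = 0 ∧ map (p * a0) q ψ = 0 ∧
      map (p * a0) (q * b0) ψ = 0) ∧
    map (p * star a0) (q * b0) ψ = (2 * (1 + ζ) / 3) • map p q ψ ∧
    map (p * a0) (q * star b0) ψ = ζ • map p q ψ := by
  have tA := h.isReflectionTriple_left ha hb h2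
  have tB := h.isReflectionTriple_right ha hb h2
  have hD : map (a1 * star a0) 1 ψ = map 1 (star b0 * b1) ψ := h.left_eq
  have hE : map (star a0 * (a1 * star a0) * a0) 1 ψ =
      map 1 (b0 * (star b0 * b1) * star b0) ψ := by
    rw [mul_assoc, mul_assoc a1, ha.star_u_mul, mul_one, ← mul_assoc b0, hb.u_mul_star, one_mul]
    exact h.left_eq'
  have n1 : (-1 : ℂ) ≠ 1 := by norm_num
  have hm := isTensorAction_tensorOp (HA := HA) (HB := HB)
  have hDu : ∀ w, (a1 * star a0) (a0 w) = a1 w := fun w => by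
    rw [← Module.End.mul_apply, mul_assoc, ha.star_u_mul, mul_one]
  subst hp hq
  refine ⟨⟨?_, ?_, ?_, ?_, ?_, ?_⟩, ?_, ?_⟩
  · refine map_eq_zero_of_eigenvalues_ne hD (c := -1) (c' := 1) (fun w hw => ?_) (fun w hw => ?_) n1
    · rw [neg_one_smul]; exact tA.negProj_D hw
    · rw [one_smul]; exact tB.negProj_star_u_D hw
  · refine map_eq_zero_of_eigenvalues_ne hD (c := -1) (c' := 1) (fun w hw => ?_) (fun w hw => ?_) n1
    · rw [neg_one_smul]; exact tA.negProj_D hw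
    · rw [one_smul]; exact tB.negProj_u_D hw
  · refine map_eq_zero_of_eigenvalues_ne hD (c := 1) (c' := -1) (fun w hw => ?_) (fun w hw => ?_)
      n1.symm
    · rw [one_smul]; exact tA.negProj_star_u_D hw
    · rw [neg_one_smul]; exact tB.negProj_D hw
  · refine map_eq_zero_of_eigenvalues_ne hE (c := 1) (c' := -1) (fun w hw => ?_) (fun w hw => ?_)
      n1.symm
    · rw [one_smul]; exact tA.negProj_star_u_conj hw
    · rw [neg_one_smul]; exact tB.negProj_star_u_conj' hw
  · refine map_eq_zero_of_eigenvalues_ne hD (c := 1) (c' := -1) (fun w hw => ?_) (fun w hw => ?_)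
      n1.symm
    · rw [one_smul]; exact tA.negProj_u_D hw
    · rw [neg_one_smul]; exact tB.negProj_D hw
  · refine map_eq_zero_of_eigenvalues_ne hE (c := -1) (c' := 1) (fun w hw => ?_) (fun w hw => ?_) n1
    · rw [neg_one_smul]; exact tA.negProj_u_conj hw
    · rw [one_smul]; exact tB.negProj_u_conj' hw
  -- In the component (1,2) both D and E act as 1, so the right side of `add_eq` becomes (4 + 3 - 1)
  -- times that component, while the left side is 4(1 + ζ) times the component (0,0).
  · have e1 := congrArg (tensorOp (negProj (a1 * star a0) * star a0)
      (negProj (star b0 * b1) * b0)) h.add_eq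
    simp only [map_smul, _root_.map_add, map_sub, hm.apply, mul_one] at e1
    rw [mul_assoc _ (star a0) a0, ha.star_u_mul, mul_one, mul_assoc _ b0 (star b0),
      hb.u_mul_star, mul_one] at e1
    have f2 : tensorOp (negProj (a1 * star a0) * star a0 * a1) (negProj (star b0 * b1)) ψ =
        tensorOp (negProj (a1 * star a0)) (negProj (star b0 * b1)) ψ :=
      map_eq_of_eqOn_leftSupport (fun w hw => by
        rw [← tA.negProj_conj hw, hDu]
        rfl) _
    have f3 : tensorOp (negProj (a1 * star a0) * star a0 * (a1 * star a0))
        (negProj (star b0 * b1) * b0) ψ =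
        tensorOp (negProj (a1 * star a0) * star a0) (negProj (star b0 * b1) * b0) ψ :=
      map_eq_of_eqOn_leftSupport (fun w hw => tA.negProj_star_u_D hw) _
    have f4 : tensorOp (negProj (a1 * star a0) * star a0 * (star a0 * a1))
        (negProj (star b0 * b1) * b0) ψ =
        tensorOp (negProj (a1 * star a0) * star a0) (negProj (star b0 * b1) * b0) ψ :=
      map_eq_of_eqOn_leftSupport (fun w hw => by
        refine Eq.trans ?_ (tA.negProj_star_u_conj hw)
        rw [hDu]
        rfl) _
    rw [f2, f3, f4] at e1
    change tensorOp _ _ ψ = _ • tensorOp _ _ ψ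
    linear_combination (norm := module) (-1 / 6 : ℂ) • e1
  -- Since pD = -p and pa₁ = pDa₀ = -pa₀ on the support, both sides of `sub_eq` double.
  · have e1 := congrArg (tensorOp (negProj (a1 * star a0)) (negProj (star b0 * b1))) h.sub_eq
    simp only [map_smul, map_sub, hm.apply, mul_one] at e1
    have f1 : tensorOp (negProj (a1 * star a0) * a1) (negProj (star b0 * b1) * star b0) ψ =
        tensorOp (-(negProj (a1 * star a0) * a0)) (negProj (star b0 * b1) * star b0) ψ :=
      map_eq_of_eqOn_leftSupport (fun w hw => by
        refine Eq.trans ?_ (tA.negProj_D (tA.u_mem w hw))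
        rw [hDu]
        rfl) _
    have f2 : tensorOp (negProj (a1 * star a0) * (a1 * star a0)) (negProj (star b0 * b1)) ψ =
        tensorOp (-negProj (a1 * star a0)) (negProj (star b0 * b1)) ψ :=
      map_eq_of_eqOn_leftSupport (fun w hw => tA.negProj_D hw) _
    rw [f1, f2, hm.neg_left, hm.neg_left, LinearMap.neg_apply, LinearMap.neg_apply] at e1
    change tensorOp _ _ ψ = _ • tensorOp _ _ ψ
    linear_combination (norm := module) (1 / 2 : ℂ) • e1

end IsMaximalState

/-! ### Regrouping tensor factors, and the matrices of 𝒮₃ on blocks. -/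

section WithJunk

variable {KA KB JA JB : Type*} [NormedAddCommGroup KA] [InnerProductSpace ℂ KA]
  [NormedAddCommGroup KB] [InnerProductSpace ℂ KB] [NormedAddCommGroup JA]
  [InnerProductSpace ℂ JA] [NormedAddCommGroup JB] [InnerProductSpace ℂ JB]

theorem withJunk_add_left (x y : KA ⊗[ℂ] KB) (j : JA ⊗[ℂ] JB) :
    withJunk (x + y) j = withJunk x j + withJunk y j :=
  (congrArg _ (TensorProduct.add_tmul x y j)).trans (map_add _ _ _)

theorem withJunk_smul_left (c : ℂ) (x : KA ⊗[ℂ] KB) (j : JA ⊗[ℂ] JB) :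
    withJunk (c • x) j = c • withJunk x j :=
  (congrArg _ (TensorProduct.smul_tmul' c x j).symm).trans (map_smul _ _ _)

theorem withJunk_smul_right (c : ℂ) (x : KA ⊗[ℂ] KB) (j : JA ⊗[ℂ] JB) :
    withJunk x (c • j) = c • withJunk x j :=
  (congrArg _ (TensorProduct.tmul_smul c x j)).trans (map_smul _ _ _)

theorem withJunk_map (x : KA →ₗ[ℂ] KA) (y : KB →ₗ[ℂ] KB) (ψ : KA ⊗[ℂ] KB) (j : JA ⊗[ℂ] JB) :
    withJunk (TensorProduct.map x y ψ) j =
      TensorProduct.map (TensorProduct.map x LinearMap.id) (TensorProduct.map y LinearMap.id)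
        (withJunk ψ j) := by
  have h := congrArg (fun f => f (ψ ⊗ₜ[ℂ] j)) (TensorProduct.tensorTensorTensorComm_comp_map
    (R := ℂ) x y (LinearMap.id (M := JA)) (LinearMap.id (M := JB)))
  simp only [LinearMap.comp_apply, TensorProduct.map_tmul, TensorProduct.map_id,
    LinearMap.id_apply] at h
  exact h

/-- Regrouping tensor factors is isometric. -/
theorem norm_withJunk (ψ : KA ⊗[ℂ] KB) (j : JA ⊗[ℂ] JB) : ‖withJunk ψ j‖ = ‖ψ‖ * ‖j‖ := by
  let T := (TensorProduct.assocIsometry ℂ KA KB (JA ⊗[ℂ] JB)).trans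
    ((((TensorProduct.assocIsometry ℂ KB JA JB).symm.trans
      ((TensorProduct.commIsometry ℂ KB JA).rTensor JB)).trans
      (TensorProduct.assocIsometry ℂ JA KB JB)).lTensor KA |>.trans
      (TensorProduct.assocIsometry ℂ KA JA (KB ⊗[ℂ] JB)).symm)
  have hT : (TensorProduct.tensorTensorTensorComm ℂ KA KB JA JB).toLinearMap =
      T.toLinearEquiv.toLinearMap := TensorProduct.ext_fourfold' fun _ _ _ _ => rfl
  have h : withJunk ψ j = T (ψ ⊗ₜ[ℂ] j) := congrArg (fun f => f (ψ ⊗ₜ[ℂ] j)) hT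
  rw [h, LinearIsometryEquiv.norm_map, TensorProduct.norm_tmul]

end WithJunk

section KetAction

variable {HA HB : Type*} [NormedAddCommGroup HA] [InnerProductSpace ℂ HA] [FiniteDimensional ℂ HA]
  [NormedAddCommGroup HB] [InnerProductSpace ℂ HB] [FiniteDimensional ℂ HB]

theorem map_ketTmul (M : Matrix (Fin 3) (Fin 3) ℂ) {i j : Fin 3} {c : ℂ}
    (hM : Matrix.toEuclideanLin M (EuclideanSpace.single i 1) = c • EuclideanSpace.single j 1)
    (x : HA) : TensorProduct.map (Matrix.toEuclideanLin M) LinearMap.id (ketTmul i x) =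
      c • ketTmul j x := by
  refine (TensorProduct.map_tmul _ _ _ _).trans ?_
  rw [hM]
  exact (TensorProduct.smul_tmul' c _ _).symm

theorem withJunk_ket (i j : Fin 3) (φ : HA ⊗[ℂ] HB) :
    withJunk (ket i j) (TensorProduct.map
      (stdOrthonormalBasis ℂ HA).repr.toLinearEquiv.toLinearMap
      (stdOrthonormalBasis ℂ HB).repr.toLinearEquiv.toLinearMap φ) =
    TensorProduct.map (ketTmul i).toLinearMap (ketTmul j).toLinearMap φ := by
  induction φ using TensorProduct.induction_on with
  | zero =>
    simp only [map_zero]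
    exact (congrArg _ (TensorProduct.tmul_zero _ _)).trans (map_zero _)
  | tmul x y => rfl
  | add x y hx hy =>
    rw [map_add, map_add, ← hx, ← hy]
    exact (congrArg _ (TensorProduct.tmul_add _ _ _)).trans (map_add _ _ _)

theorem toEuclideanLin_single (M : Matrix (Fin 3) (Fin 3) ℂ) (i : Fin 3) :
    Matrix.toEuclideanLin M (EuclideanSpace.single i 1) = WithLp.toLp 2 (M.col i) := by
  ext k
  simp [Matrix.toLpLin_apply]

theorem matA_zero_ketTmul (x y z : HA) :
    TensorProduct.map (Matrix.toEuclideanLin (matA 0)) LinearMap.id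
      (ketTmul 0 x + ketTmul 1 y + ketTmul 2 z) = ketTmul 0 z + ketTmul 1 x + ketTmul 2 y := by
  have h0 := map_ketTmul (matA 0) (i := 0) (j := 1) (c := 1) (by
    rw [toEuclideanLin_single]; ext k; fin_cases k <;> simp [matA]) x
  have h1 := map_ketTmul (matA 0) (i := 1) (j := 2) (c := 1) (by
    rw [toEuclideanLin_single]; ext k; fin_cases k <;> simp [matA]) y
  have h2 := map_ketTmul (matA 0) (i := 2) (j := 0) (c := 1) (by
    rw [toEuclideanLin_single]; ext k; fin_cases k <;> simp [matA]) z
  refine (map_add _ _ _).trans ((congrArg₂ _ (map_add _ _ _) h2).trans ?_)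
  refine (congrArg₂ _ (congrArg₂ _ h0 h1) rfl).trans ?_
  rw [one_smul, one_smul, one_smul]
  abel

theorem matA_one_ketTmul (x y z : HA) :
    TensorProduct.map (Matrix.toEuclideanLin (matA 1)) LinearMap.id
      (ketTmul 0 x + ketTmul 1 y + ketTmul 2 z) =
    z12 ^ 2 • (-ketTmul 0 z + ketTmul 1 x + ketTmul 2 y) := by
  have h0 := map_ketTmul (matA 1) (i := 0) (j := 1) (c := z12 ^ 2) (by
    rw [toEuclideanLin_single]; ext k; fin_cases k <;> simp [matA]) x
  have h1 := map_ketTmul (matA 1) (i := 1) (j := 2) (c := z12 ^ 2) (by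
    rw [toEuclideanLin_single]; ext k; fin_cases k <;> simp [matA]) y
  have h2 := map_ketTmul (matA 1) (i := 2) (j := 0) (c := -z12 ^ 2) (by
    rw [toEuclideanLin_single]; ext k; fin_cases k <;> simp [matA]) z
  refine (map_add _ _ _).trans ((congrArg₂ _ (map_add _ _ _) h2).trans ?_)
  refine (congrArg₂ _ (congrArg₂ _ h0 h1) rfl).trans ?_
  module

theorem matB_zero_eq : matB 0 = matA 0 := by
  simp only [matA, matB, Matrix.cons_val_zero]

theorem matB_one_ketTmul (x y z : HA) :
    TensorProduct.map (Matrix.toEuclideanLin (matB 1)) LinearMap.id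
      (ketTmul 0 x + ketTmul 1 y + ketTmul 2 z) =
    z12 ^ 2 • (-ketTmul 0 y + ketTmul 1 z + ketTmul 2 x) := by
  have h0 := map_ketTmul (matB 1) (i := 0) (j := 2) (c := z12 ^ 2) (by
    rw [toEuclideanLin_single]; ext k; fin_cases k <;> simp [matB]) x
  have h1 := map_ketTmul (matB 1) (i := 1) (j := 0) (c := -z12 ^ 2) (by
    rw [toEuclideanLin_single]; ext k; fin_cases k <;> simp [matB]) y
  have h2 := map_ketTmul (matB 1) (i := 2) (j := 1) (c := z12 ^ 2) (by
    rw [toEuclideanLin_single]; ext k; fin_cases k <;> simp [matB]) z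
  refine (map_add _ _ _).trans ((congrArg₂ _ (map_add _ _ _) h2).trans ?_)
  refine (congrArg₂ _ (congrArg₂ _ h0 h1) rfl).trans ?_
  module

end KetAction

/-! ### The local isometries for an optimal state. -/

section Rigidity

variable {HA HB : Type*} [NormedAddCommGroup HA] [InnerProductSpace ℂ HA] [FiniteDimensional ℂ HA]
  [NormedAddCommGroup HB] [InnerProductSpace ℂ HB] [FiniteDimensional ℂ HB]
  {a0 a1 : Module.End ℂ HA} {b0 b1 : Module.End ℂ HB} {ψ : HA ⊗[ℂ] HB}

/-- The junk state is the normalized (0,0) component. The observables are intertwined only on the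
supports, which suffices because they act on ψ. The factors `z12 ^ 2` undo the phases absorbed in a₁
and b₁. -/
theorem IsMaximalState.exists_isometries
    (h : IsMaximalState tensorOp a0 a1 b0 b1 (z12 ^ 2) ψ) (ha : IsCubicPair a0 a1)
    (hb : IsCubicPair b0 b1) (hψ : ‖ψ‖ = 1) :
    ∃ (dA dB : ℕ) (VA : HA →ₗᵢ[ℂ] EuclideanSpace ℂ (Fin 3) ⊗[ℂ] EuclideanSpace ℂ (Fin dA))
      (VB : HB →ₗᵢ[ℂ] EuclideanSpace ℂ (Fin 3) ⊗[ℂ] EuclideanSpace ℂ (Fin dB))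
      (junk : EuclideanSpace ℂ (Fin dA) ⊗[ℂ] EuclideanSpace ℂ (Fin dB)),
      ‖junk‖ = 1 ∧
      TensorProduct.map VA.toLinearMap VB.toLinearMap ψ = withJunk psi3 junk ∧
      (∀ w ∈ leftSupport ψ, VA (a0 w) =
        TensorProduct.map (Matrix.toEuclideanLin (matA 0)) LinearMap.id (VA w)) ∧
      (∀ w ∈ leftSupport ψ, z12 ^ 2 • VA (a1 w) =
        TensorProduct.map (Matrix.toEuclideanLin (matA 1)) LinearMap.id (VA w)) ∧
      (∀ w ∈ rightSupport ψ, VB (b0 w) =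
        TensorProduct.map (Matrix.toEuclideanLin (matB 0)) LinearMap.id (VB w)) ∧
      (∀ w ∈ rightSupport ψ, z12 ^ 2 • VB (star b1 w) =
        TensorProduct.map (Matrix.toEuclideanLin (matB 1)) LinearMap.id (VB w)) := by
  have h2 : (z12 ^ 2) ^ 2 = z12 ^ 2 - 1 := by rw [← z12_pow_four]; ring
  have tA := h.isReflectionTriple_left ha hb h2
  have tB := h.isReflectionTriple_right ha hb h2
  obtain ⟨VA, hVA⟩ := tA.exists_isometry
  obtain ⟨VB, hVB⟩ := tB.exists_isometry
  obtain ⟨⟨h01, h02, h10, h11, h20, h22⟩, h12, h21⟩ := h.components ha hb h2 rfl rfl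
  have hmap := map_sum_eq_of_components (k0 := (ketTmul 0).toLinearMap)
    (k1 := (ketTmul 1).toLinearMap) (k2 := (ketTmul 2).toLinearMap)
    (l0 := (ketTmul 0).toLinearMap) (l1 := (ketTmul 1).toLinearMap)
    (l2 := (ketTmul 2).toLinearMap) h01 h02 h10 h11 h20 h22 h12 h21
  have hV : TensorProduct.map VA.toLinearMap VB.toLinearMap ψ = _ :=
    (map_eq_of_eqOn_leftSupport hVA _).trans ((map_eq_of_eqOn_rightSupport hVB _).trans hmap)
  generalize TensorProduct.map (negProj (a1 * star a0)) (negProj (star b0 * b1)) ψ = φ at hV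
  rw [← withJunk_ket, ← withJunk_ket, ← withJunk_ket] at hV
  have hα : (2 - z12 ^ 2) * (1 + z12 ^ 2) = 3 := by linear_combination -h2
  have hα0 : 2 - z12 ^ 2 ≠ 0 := fun h0 => by rw [h0, zero_mul] at hα; norm_num at hα
  have h10 : (Real.sqrt 10 : ℂ) ≠ 0 := by simp
  have hVj : TensorProduct.map VA.toLinearMap VB.toLinearMap ψ = withJunk psi3
      -- The coefficient of |00⟩ in `psi3` is (1 - z⁴)/√10 = (2 - ζ)/√10; its inverse normalizes the
      -- junk.
      (((Real.sqrt 10 : ℂ) / (2 - z12 ^ 2)) • TensorProduct.map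
        (stdOrthonormalBasis ℂ HA).repr.toLinearEquiv.toLinearMap
        (stdOrthonormalBasis ℂ HB).repr.toLinearEquiv.toLinearMap φ) := by
    rw [hV, withJunk_smul_right, psi3, withJunk_smul_left, withJunk_add_left, withJunk_add_left,
      withJunk_smul_left, withJunk_smul_left, withJunk_smul_left, smul_smul,
      show (Real.sqrt 10 : ℂ) / (2 - z12 ^ 2) * (1 / (Real.sqrt 10 : ℂ)) = (2 - z12 ^ 2)⁻¹ by
        field_simp, z12_pow_four]
    have c1 : 2 - z12 ^ 2 = 1 - (z12 ^ 2 - 1) := by ring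
    have c2 : 2 * (1 + z12 ^ 2) / 3 = (2 - z12 ^ 2)⁻¹ * 2 := by
      rw [← hα]
      have : 1 + z12 ^ 2 ≠ 0 := fun h0 => by rw [h0, mul_zero] at hα; norm_num at hα
      field_simp
    have c3 : z12 ^ 2 = (2 - z12 ^ 2)⁻¹ * (1 + z12 ^ 2) := by
      field_simp
      linear_combination -h2
    rw [smul_add, smul_add, smul_smul, smul_smul, smul_smul, ← c1, ← c2, ← c3,
      inv_mul_cancel₀ hα0, one_smul]
  refine ⟨_, _, VA, VB, _, ?_, hVj, fun w hw => ?_, fun w hw => ?_, fun w hw => ?_,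
    fun w hw => ?_⟩
  · have h3 := congrArg norm hVj
    rw [norm_withJunk, norm_psi3, one_mul] at h3
    exact h3.symm.trans ((TensorProduct.norm_map VA VB ψ).trans hψ)
  · rw [hVA _ (tA.u_mem w hw), hVA w hw, tA.star_u_mul_apply, tA.u_sq_apply]
    exact (matA_zero_ketTmul _ _ _).symm
  · have hD : a1 w = (a1 * star a0) (a0 w) := by
      rw [← Module.End.mul_apply, mul_assoc, ha.star_u_mul, mul_one]
    have h0 := tA.u_mem w hw
    rw [hD, hVA _ (tA.D_mem _ h0), hVA w hw, tA.negProj_D h0, tA.negProj_star_u_D h0,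
      tA.negProj_u_D h0, tA.star_u_mul_apply, tA.u_sq_apply, map_neg]
    exact (matA_one_ketTmul _ _ _).symm
  · rw [hVB _ (tB.u_mem w hw), hVB w hw, tB.star_u_mul_apply, tB.u_sq_apply, matB_zero_eq]
    exact (matA_zero_ketTmul _ _ _).symm
  · have h0 := tB.star_u_mem hw
    -- With F = b₀†b₁ one has b₁† = F†b₀†, and F† = F on the support.
    have hD : star b1 w = (star b0 * b1) (star b0 w) := by
      rw [← tB.star_D_apply h0, ← Module.End.mul_apply, star_mul, star_star, mul_assoc,
        hb.u_mul_star, mul_one]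
    rw [hD, hVB _ (tB.D_mem _ h0), hVB w hw, tB.negProj_D h0, tB.negProj_star_u_D h0,
      tB.negProj_u_D h0, tB.star_u_sq_apply, tB.u_mul_star_apply, map_neg]
    exact (matB_one_ketTmul _ _ _).symm

end Rigidity

/-! ### Observables of projective measurements. -/

section ProjectiveMeasurement

variable {ι H : Type*} [Fintype ι] [NormedAddCommGroup H] [InnerProductSpace ℂ H]

/-- The projections of a projective measurement are mutually orthogonal. -/
theorem proj_mul_proj_eq_zero {E : ι → H →ₗ[ℂ] H} (hE : ∀ a, (E a).IsSymmetricProjection)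
    (hsum : ∑ a, E a = LinearMap.id) {a b : ι} (hab : a ≠ b) (x : H) : E a (E b x) = 0 := by
  classical
  have hid : ∀ c y, E c (E c y) = E c y := fun c y => congrArg (fun f => f y) (hE c).isIdempotentElem
  have hn : ∀ c y, (inner ℂ y (E c y)).re = ‖E c y‖ ^ 2 := fun c y => by
    rw [← re_inner_self, ← hid c y, ← (hE c).isSymmetric (y) (E c y), hid]
  -- Taking the inner product with E_b x gives ‖E_b x‖² = ∑ ‖E_c E_b x‖²; the term c = b already
  -- exhausts it, so the others vanish.
  have h1 : E b x = ∑ c, E c (E b x) := by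
    have := congrArg (fun f : H →ₗ[ℂ] H => f (E b x)) hsum
    simpa using this.symm
  have h2 : ‖E b x‖ ^ 2 = ∑ c, ‖E c (E b x)‖ ^ 2 := by
    have h := congrArg (fun v => (inner ℂ (E b x) v).re) h1
    simp only [re_inner_self, inner_sum, Complex.re_sum] at h
    rw [h]
    exact Finset.sum_congr rfl fun c _ => hn c _
  rw [← Finset.add_sum_erase _ _ (Finset.mem_univ b), hid] at h2
  have h3 : ∑ c ∈ Finset.univ.erase b, ‖E c (E b x)‖ ^ 2 = 0 := by linarith
  have h4 := (Finset.sum_eq_zero_iff_of_nonneg fun c _ => sq_nonneg _).1 h3 a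
    (Finset.mem_erase.2 ⟨hab, Finset.mem_univ a⟩)
  exact norm_eq_zero.1 (pow_eq_zero_iff two_ne_zero |>.1 h4)

theorem sum_smul_proj_mul {E : ι → Module.End ℂ H} (hE : ∀ a, (E a).IsSymmetricProjection)
    (hsum : ∑ a, E a = LinearMap.id) (c d : ι → ℂ) :
    (∑ a, c a • E a) * (∑ a, d a • E a) = ∑ a, (c a * d a) • E a := by
  classical
  rw [Finset.sum_mul_sum]
  refine Finset.sum_congr rfl fun a _ => ?_
  rw [Finset.sum_eq_single a]
  · rw [smul_mul_smul_comm, (hE a).isIdempotentElem.eq]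
  · intro b _ hb
    have : E a * E b = 0 := LinearMap.ext fun x => proj_mul_proj_eq_zero hE hsum hb.symm x
    rw [smul_mul_smul_comm, this, smul_zero]
  · simp

end ProjectiveMeasurement

theorem rootOfUnity_three : rootOfUnity 3 = z12 ^ 2 - 1 := by
  rw [← z12_pow_four, rootOfUnity, z12, ← Complex.exp_nat_mul]
  congr 1
  push_cast
  ring

theorem rootOfUnity_three_cube : rootOfUnity 3 ^ 3 = 1 :=
  (rootOfUnity_isPrimitiveRoot 3).pow_eq_one

/-- A unitary whose cube is `1`. -/
structure IsCubicUnitary {R : Type*} [Ring R] [StarRing R] (u : R) : Prop where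
  star_mul : star u * u = 1
  mul_star : u * star u = 1
  sq : u * u = star u

theorem IsCubicUnitary.isCubicPair_smul {R : Type*} [Ring R] [StarRing R] [Algebra ℂ R]
    [StarModule ℂ R] {u w : R} (hu : IsCubicUnitary u) (hw : IsCubicUnitary w) {ζ : ℂ}
    (h1 : star ζ = 1 - ζ) (h2 : ζ ^ 2 = ζ - 1) : IsCubicPair u ((1 - ζ) • w) := by
  have h3 : star (1 - ζ) = ζ := by rw [star_sub, star_one, h1]; ring
  have h4 : ζ * (1 - ζ) = 1 := by linear_combination -h2
  refine ⟨hu.star_mul, hu.mul_star, hu.sq, ?_, ?_, ?_⟩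
  · rw [star_smul, smul_mul_smul_comm, hw.star_mul, h3, h4, one_smul]
  · rw [star_smul, smul_mul_smul_comm, hw.mul_star, h3, mul_comm, h4, one_smul]
  · rw [star_smul, smul_mul_smul_comm, hw.sq, h3, ← neg_smul]
    congr 1
    linear_combination h2

theorem IsCubicUnitary.isCubicPair_smul_star {R : Type*} [Ring R] [StarRing R] [Algebra ℂ R]
    [StarModule ℂ R] {u w : R} (hu : IsCubicUnitary u) (hw : IsCubicUnitary w) {ζ : ℂ}
    (h1 : star ζ = 1 - ζ) (h2 : ζ ^ 2 = ζ - 1) : IsCubicPair u (ζ • star w) := by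
  have h4 : ζ * (1 - ζ) = 1 := by linear_combination -h2
  have h5 : star w * star w = w := by
    rw [← StarMul.star_mul, hw.sq, star_star]
  refine ⟨hu.star_mul, hu.mul_star, hu.sq, ?_, ?_, ?_⟩
  · rw [star_smul, smul_mul_smul_comm, star_star, hw.mul_star, h1, mul_comm, h4, one_smul]
  · rw [star_smul, smul_mul_smul_comm, star_star, hw.star_mul, h1, h4, one_smul]
  · rw [star_smul, smul_mul_smul_comm, h5, h1, star_star, ← neg_smul]
    congr 1
    linear_combination h2

section Observable

variable {H : Type*} [NormedAddCommGroup H] [InnerProductSpace ℂ H] [FiniteDimensional ℂ H]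

theorem isCubicUnitary_observable {E : ZMod 3 → Module.End ℂ H}
    (hE : ∀ a, (E a).IsSymmetricProjection) (hsum : ∑ a, E a = LinearMap.id) :
    IsCubicUnitary (∑ a : ZMod 3, rootOfUnity 3 ^ a.val • E a) := by
  have hs : ∀ a, star (E a) = E a := fun a =>
    (LinearMap.isStarProjection_iff_isSymmetricProjection.2 (hE a)).isSelfAdjoint
  have hstar : star (∑ a : ZMod 3, rootOfUnity 3 ^ a.val • E a) =
      ∑ a : ZMod 3, (rootOfUnity 3 ^ a.val)⁻¹ • E a := by
    rw [star_sum]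
    refine Finset.sum_congr rfl fun a _ => ?_
    rw [star_smul, hs, star_pow, star_rootOfUnity, inv_pow]
  have h0 : ∀ a : ZMod 3, rootOfUnity 3 ^ a.val ≠ 0 := fun a =>
    pow_ne_zero _ (Complex.exp_ne_zero _)
  have h3 : ∀ a : ZMod 3, rootOfUnity 3 ^ a.val * rootOfUnity 3 ^ a.val =
      (rootOfUnity 3 ^ a.val)⁻¹ := fun a => by
    refine eq_inv_of_mul_eq_one_left ?_
    rw [← pow_two, ← pow_succ, ← pow_mul, mul_comm, pow_mul,
      rootOfUnity_three_cube, one_pow]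
  have h1 : ∑ a, E a = (1 : Module.End ℂ H) := hsum
  refine ⟨?_, ?_, ?_⟩
  · rw [hstar, sum_smul_proj_mul hE hsum]
    simp only [inv_mul_cancel₀ (h0 _), one_smul, h1]
  · rw [hstar, sum_smul_proj_mul hE hsum]
    simp only [mul_inv_cancel₀ (h0 _), one_smul, h1]
  · rw [hstar, sum_smul_proj_mul hE hsum]
    simp only [h3]

end Observable

theorem sum_zmod_three {M : Type*} [AddCommMonoid M] (f : ZMod 3 → M) :
    ∑ a, f a = f 0 + f 1 + f 2 :=
  Fin.sum_univ_three f

theorem star_z12_sq : star (z12 ^ 2) = 1 - z12 ^ 2 := conj_z12_sq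

theorem z12_sq_sq : (z12 ^ 2) ^ 2 = z12 ^ 2 - 1 := by
  rw [← z12_pow_four]
  ring

theorem z12_sq_re : (z12 ^ 2).re = 1 / 2 := by
  have h := congrArg Complex.re star_z12_sq
  have h1 : (star (z12 ^ 2)).re = (z12 ^ 2).re := Complex.conj_re _
  rw [h1, Complex.sub_re, Complex.one_re] at h
  linarith

theorem rootOfUnity_three_pow_val :
    rootOfUnity 3 ^ (0 : ZMod 3).val = 1 ∧ rootOfUnity 3 ^ (1 : ZMod 3).val = z12 ^ 2 - 1 ∧
      rootOfUnity 3 ^ (2 : ZMod 3).val = -z12 ^ 2 := by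
  refine ⟨pow_zero _, (pow_one _).trans rootOfUnity_three, ?_⟩
  change rootOfUnity 3 ^ 2 = _
  rw [rootOfUnity_three]
  linear_combination z12_sq_sq

theorem IsTensorAction.inner_sum_sum {ι κ RA RB H : Type*} [Fintype ι] [Fintype κ] [Ring RA]
    [StarRing RA] [Algebra ℂ RA] [Ring RB] [StarRing RB] [Algebra ℂ RB] [NormedAddCommGroup H]
    [InnerProductSpace ℂ H] [FiniteDimensional ℂ H] {m : RA → RB → Module.End ℂ H}
    (hm : IsTensorAction m) (c : ι → ℂ) (d : κ → ℂ) (E : ι → RA) (F : κ → RB) (ψ : H) :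
    inner ℂ ψ (m (∑ a, c a • E a) (∑ b, d b • F b) ψ) =
      ∑ a, ∑ b, c a * d b * inner ℂ ψ (m (E a) (F b) ψ) := by
  let L : RA →+ RB →+ ℂ :=
    { toFun := fun x =>
        { toFun := fun y => inner ℂ ψ (m x y ψ)
          map_zero' := by
            rw [← zero_smul ℂ (0 : RB), hm.smul_right, zero_smul, LinearMap.zero_apply,
              inner_zero_right]
          map_add' := fun y y' => by
            rw [hm.add_right, LinearMap.add_apply, inner_add_right] }
      map_zero' := by
        ext y
        change inner ℂ ψ (m 0 y ψ) = 0
        rw [← zero_smul ℂ (0 : RA), hm.smul_left, zero_smul, LinearMap.zero_apply,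
          inner_zero_right]
      map_add' := fun x x' => by
        ext y
        change inner ℂ ψ (m (x + x') y ψ) = inner ℂ ψ (m x y ψ) + inner ℂ ψ (m x' y ψ)
        rw [hm.add_left, LinearMap.add_apply, inner_add_right] }
  have h : L (∑ a, c a • E a) (∑ b, d b • F b) = ∑ a, ∑ b, L (c a • E a) (d b • F b) := by
    rw [map_sum L, AddMonoidHom.finsetSum_apply]
    exact Finset.sum_congr rfl fun a _ => map_sum _ _ _
  refine h.trans (Finset.sum_congr rfl fun a _ => Finset.sum_congr rfl fun b _ => ?_)
  change inner ℂ ψ (m (c a • E a) (d b • F b) ψ) = _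
  rw [hm.smul_left, hm.smul_right, smul_smul, LinearMap.smul_apply, inner_smul_right]

/-! ### Winning probability as the expectation of K. -/

section WinningProbability

open TensorProduct

variable {HA HB : Type*} [NormedAddCommGroup HA] [InnerProductSpace ℂ HA] [FiniteDimensional ℂ HA]
  [NormedAddCommGroup HB] [InnerProductSpace ℂ HB] [FiniteDimensional ℂ HB]

namespace QuantumStrategy

variable (S : QuantumStrategy (Fin 2) (Fin 2) (ZMod 3) (ZMod 3) HA HB)

theorem isCubicUnitary_obsA (i : Fin 2) : IsCubicUnitary (R := Module.End ℂ HA) (S.obsA i) :=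
  isCubicUnitary_observable (S.E_proj i) (S.E_sum i)

theorem isCubicUnitary_obsB (j : Fin 2) : IsCubicUnitary (R := Module.End ℂ HB) (S.obsB j) :=
  isCubicUnitary_observable (S.F_proj j) (S.F_sum j)

theorem inner_answer_eq_ofReal (i j : Fin 2) (a b : ZMod 3) :
    inner ℂ S.psi (map (S.E i a) (S.F j b) S.psi) = (S.answerProb i j a b : ℂ) := by
  have hE : star (S.E i a) = S.E i a :=
    (LinearMap.isStarProjection_iff_isSymmetricProjection.2 (S.E_proj i a)).isSelfAdjoint
  have hF : star (S.F j b) = S.F j b :=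
    (LinearMap.isStarProjection_iff_isSymmetricProjection.2 (S.F_proj j b)).isSelfAdjoint
  have hs : star (tensorOp (S.E i a) (S.F j b)) = tensorOp (S.E i a) (S.F j b) := by
    rw [isTensorAction_tensorOp.star, hE, hF]
  have h := inner_star_mul hs 1 S.psi
  rw [mul_one, Module.End.one_apply] at h
  refine (Complex.conj_eq_iff_re.1 ?_).symm
  exact (inner_conj_symm (𝕜 := ℂ) (tensorOp (S.E i a) (S.F j b) S.psi) S.psi).trans h.symm

theorem inner_tensorOp_sum (i j : Fin 2) (c d : ZMod 3 → ℂ) :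
    inner ℂ S.psi (tensorOp (∑ a, c a • S.E i a) (∑ b, d b • S.F j b) S.psi) =
      ∑ a, ∑ b, c a * d b * S.answerProb i j a b := by
  simp only [← inner_answer_eq_ofReal]
  exact isTensorAction_tensorOp.inner_sum_sum c d (S.E i) (S.F j) S.psi

theorem sum_answerProb (i j : Fin 2) : ∑ a, ∑ b, S.answerProb i j a b = 1 := by
  have h := S.inner_tensorOp_sum i j (fun _ => 1) (fun _ => 1)
  simp only [one_smul, one_mul, S.E_sum, S.F_sum] at h
  have h1 : tensorOp (LinearMap.id : HA →ₗ[ℂ] HA) (LinearMap.id : HB →ₗ[ℂ] HB) S.psi = S.psi :=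
    congrArg (fun f => f S.psi) TensorProduct.map_id
  rw [h1] at h
  have h2 := congrArg Complex.re h
  have hp : (inner ℂ S.psi S.psi).re = ‖S.psi‖ ^ 2 := re_inner_self S.psi
  rw [hp, S.norm_psi] at h2
  have h3 : (∑ a, ∑ b, (S.answerProb i j a b : ℂ)) = ((∑ a, ∑ b, S.answerProb i j a b : ℝ) : ℂ) := by
    push_cast
    rfl
  rw [h3, Complex.ofReal_re] at h2
  linarith

theorem star_obsB (j : Fin 2) :
    star (S.obsB j) = ∑ b : ZMod 3, (rootOfUnity 3 ^ b.val)⁻¹ • S.F j b := by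
  have hF : ∀ b, star (S.F j b) = S.F j b := fun b =>
    (LinearMap.isStarProjection_iff_isSymmetricProjection.2 (S.F_proj j b)).isSelfAdjoint
  rw [obsB, star_sum]
  refine Finset.sum_congr rfl fun b _ => ?_
  rw [star_smul, hF, star_pow, star_rootOfUnity, inv_pow]

theorem _root_.inv_rootOfUnity_three_pow_val :
    (rootOfUnity 3 ^ (0 : ZMod 3).val)⁻¹ = 1 ∧ (rootOfUnity 3 ^ (1 : ZMod 3).val)⁻¹ = -z12 ^ 2 ∧
      (rootOfUnity 3 ^ (2 : ZMod 3).val)⁻¹ = z12 ^ 2 - 1 := by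
  obtain ⟨h0, h1, h2⟩ := rootOfUnity_three_pow_val
  refine ⟨by rw [h0, inv_one], ?_, ?_⟩
  · rw [h1]
    exact inv_eq_of_mul_eq_one_right (by linear_combination -z12_sq_sq)
  · rw [h2]
    exact inv_eq_of_mul_eq_one_right (by linear_combination -z12_sq_sq)

theorem biasOperator_observables :
    biasOperator tensorOp (z12 ^ 2) (S.obsA 0) ((1 - z12 ^ 2) • S.obsA 1) (S.obsB 0)
      (z12 ^ 2 • star (S.obsB 1)) S.psi = tensorOp (S.obsA 0) (star (S.obsB 0)) S.psi +
      tensorOp (S.obsA 1) (star (S.obsB 0)) S.psi + tensorOp (S.obsA 0) (S.obsB 1) S.psi -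
      z12 ^ 2 • tensorOp (S.obsA 1) (S.obsB 1) S.psi := by
  have hm := isTensorAction_tensorOp (HA := HA) (HB := HB)
  rw [biasOperator, star_smul, star_star, star_z12_sq]
  simp only [hm.smul_left, hm.smul_right, LinearMap.add_apply, LinearMap.smul_apply]
  match_scalars <;>
    first | ring1 | linear_combination z12_sq_sq | linear_combination -z12_sq_sq

theorem winProb_gameZ_three :
    S.winProb (gameZ 3) = 1 / 3 + 1 / 6 * (inner ℂ S.psi (biasOperator tensorOp (z12 ^ 2) (S.obsA 0)
      ((1 - z12 ^ 2) • S.obsA 1) (S.obsB 0) (z12 ^ 2 • star (S.obsB 1)) S.psi)).re := by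
  have h00 := S.inner_tensorOp_sum 0 0 (fun a => rootOfUnity 3 ^ a.val)
    (fun b => (rootOfUnity 3 ^ b.val)⁻¹)
  have h10 := S.inner_tensorOp_sum 1 0 (fun a => rootOfUnity 3 ^ a.val)
    (fun b => (rootOfUnity 3 ^ b.val)⁻¹)
  have h01 := S.inner_tensorOp_sum 0 1 (fun a => rootOfUnity 3 ^ a.val)
    (fun b => rootOfUnity 3 ^ b.val)
  have h11 := S.inner_tensorOp_sum 1 1 (fun a => rootOfUnity 3 ^ a.val)
    (fun b => rootOfUnity 3 ^ b.val)
  rw [← star_obsB, ← obsA] at h00 h10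
  rw [← obsA, ← obsB] at h01 h11
  have s00 := S.sum_answerProb 0 0
  have s01 := S.sum_answerProb 0 1
  have s10 := S.sum_answerProb 1 0
  have s11 := S.sum_answerProb 1 1
  have hi : ∀ (c : ℂ) x, inner ℂ S.psi (c • x) = c * inner ℂ S.psi x := fun c x =>
    inner_smul_right S.psi x c
  rw [biasOperator_observables, inner_sub_right, inner_add_right, inner_add_right, hi, h00, h10, h01, h11]
  obtain ⟨r0, r1, r2⟩ := rootOfUnity_three_pow_val
  obtain ⟨i0, i1, i2⟩ := inv_rootOfUnity_three_pow_val
  simp only [sum_zmod_three, i0, i1, i2] at s00 s01 s10 s11 ⊢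
  simp only [r0, r1, r2]
  have hre := z12_sq_re
  have hsq := z12_sq_sq
  generalize z12 ^ 2 = ζ at hre hsq ⊢
  -- Multiplication table of the cube roots of unity 1, ζ - 1, -ζ, together with the extra phase ζ.
  -- Every real part becomes a rational number, leaving a linear identity in the answer
  -- probabilities.
  have m1 : (ζ - 1) * (ζ - 1) = -ζ := by linear_combination hsq
  have m2 : (ζ - 1) * -ζ = 1 := by linear_combination -hsq
  have m3 : -ζ * (ζ - 1) = 1 := by linear_combination -hsq
  have m4 : -ζ * -ζ = ζ - 1 := by linear_combination hsq
  have m5 : ζ * (ζ - 1) = -1 := by linear_combination hsq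
  have m6 : ζ * -ζ = 1 - ζ := by linear_combination -hsq
  simp only [mul_add, ← mul_assoc ζ, one_mul, mul_one, m1, m2, m3, m4, m5, m6, Complex.add_re,
    Complex.sub_re, Complex.re_mul_ofReal, Complex.neg_re, Complex.one_re, Complex.ofReal_re, hre]
  simp only [winProb, gameZ, Fin.sum_univ_two, sum_zmod_three, Fin.isValue]
  simp [show (1 : ZMod 3) ≠ 2 by decide, show (2 : ZMod 3) ≠ 1 by decide,
    show (2 : ZMod 3) ≠ 0 by decide, show (0 : ZMod 3) ≠ 2 by decide,
    show (1 : ZMod 3) + 1 = 2 by decide, show (1 : ZMod 3) + 2 = 0 by decide,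
    show (2 : ZMod 3) + 1 = 0 by decide, show (2 : ZMod 3) + 2 = 1 by decide]
  linarith

end QuantumStrategy

end WinningProbability

/-! ### The value of 𝒮₃. -/

section StrategyValue

theorem inner_ket_map (M N : Matrix (Fin 3) (Fin 3) ℂ) (i j k l : Fin 3) :
    inner ℂ (ket i j) (tensorOp (Matrix.toEuclideanLin M) (Matrix.toEuclideanLin N) (ket k l)) =
      M i k * N j l := by
  have h : tensorOp (Matrix.toEuclideanLin M) (Matrix.toEuclideanLin N) (ket k l) =
      WithLp.toLp 2 (M.col k) ⊗ₜ[ℂ] WithLp.toLp 2 (N.col l) := by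
    refine (TensorProduct.map_tmul _ _ _ _).trans ?_
    rw [toEuclideanLin_single, toEuclideanLin_single]
  rw [h]
  refine (TensorProduct.inner_tmul (𝕜 := ℂ) _ _ _ _).trans ?_
  rw [EuclideanSpace.inner_single_left, EuclideanSpace.inner_single_left]
  simp

theorem inner_map_combination {H : Type*} [NormedAddCommGroup H] [InnerProductSpace ℂ H]
    (T : Module.End ℂ H) (s a b c : ℂ) (x y z : H) :
    inner ℂ (s • (a • x + b • y + c • z)) (T (s • (a • x + b • y + c • z))) =
      star s * s *
        (star a * (a * inner ℂ x (T x) + b * inner ℂ x (T y) + c * inner ℂ x (T z)) +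
          star b * (a * inner ℂ y (T x) + b * inner ℂ y (T y) + c * inner ℂ y (T z)) +
          star c * (a * inner ℂ z (T x) + b * inner ℂ z (T y) + c * inner ℂ z (T z))) := by
  simp only [map_smul, map_add, inner_smul_left, inner_smul_right, inner_add_left,
    inner_add_right, starRingEnd_apply]
  ring

theorem inner_psi3_map (M N : Matrix (Fin 3) (Fin 3) ℂ) :
    inner ℂ psi3 (tensorOp (Matrix.toEuclideanLin M) (Matrix.toEuclideanLin N) psi3) =
      1 / 10 * ((1 + z12 ^ 2) *
        ((2 - z12 ^ 2) * (M 0 0 * N 0 0) + 2 * (M 0 1 * N 0 2) + (1 + z12 ^ 2) * (M 0 2 * N 0 1)) +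
        2 * ((2 - z12 ^ 2) * (M 1 0 * N 2 0) + 2 * (M 1 1 * N 2 2) +
          (1 + z12 ^ 2) * (M 1 2 * N 2 1)) +
        (2 - z12 ^ 2) * ((2 - z12 ^ 2) * (M 2 0 * N 1 0) + 2 * (M 2 1 * N 1 2) +
          (1 + z12 ^ 2) * (M 2 2 * N 1 1))) := by
  have hs : star (1 / (Real.sqrt 10 : ℂ)) * (1 / (Real.sqrt 10 : ℂ)) = 1 / 10 := by
    have h10 : ((Real.sqrt 10 : ℝ) : ℂ) * (Real.sqrt 10 : ℝ) = 10 := by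
      rw [← Complex.ofReal_mul, Real.mul_self_sqrt (by norm_num)]
      norm_num
    rw [star_div₀, star_one, Complex.star_def, Complex.conj_ofReal, div_mul_div_comm, h10, one_mul]
  have hp : 1 - z12 ^ 4 = 2 - z12 ^ 2 := by rw [z12_pow_four]; ring
  have hp' : star (2 - z12 ^ 2) = 1 + z12 ^ 2 := by
    rw [star_sub, star_z12_sq, star_ofNat]; ring
  have hq' : star (1 + z12 ^ 2) = 2 - z12 ^ 2 := by
    rw [star_add, star_z12_sq, star_one]; ring
  refine (inner_map_combination (H := EuclideanSpace ℂ (Fin 3) ⊗[ℂ] EuclideanSpace ℂ (Fin 3))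
    (tensorOp (Matrix.toEuclideanLin M) (Matrix.toEuclideanLin N)) (1 / (Real.sqrt 10 : ℂ))
    (1 - z12 ^ 4) 2 (1 + z12 ^ 2) (ket 0 0) (ket 1 2) (ket 2 1)).trans ?_
  rw [hs, hp, hp', hq', star_ofNat]
  simp only [inner_ket_map]

theorem re_inner_strategy3_biasOperator :
    (inner ℂ strategy3.psi (biasOperator tensorOp (z12 ^ 2) (strategy3.obsA 0)
      ((1 - z12 ^ 2) • strategy3.obsA 1) (strategy3.obsB 0)
      (z12 ^ 2 • star (strategy3.obsB 1)) strategy3.psi)).re = 3 := by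
  have hstar : star (Matrix.toEuclideanLin (matB 0)) =
      Matrix.toEuclideanLin (matB 0).conjTranspose :=
    (Matrix.toEuclideanLin_conjTranspose_eq_adjoint _).symm
  have hi : ∀ (c : ℂ) x, inner ℂ psi3 (c • x) = c * inner ℂ psi3 x := fun c x =>
    inner_smul_right psi3 x c
  have hψ : strategy3.psi = psi3 := rfl
  rw [QuantumStrategy.biasOperator_observables, hψ, strategy3_obsA, strategy3_obsA, strategy3_obsB,
    strategy3_obsB, hstar, inner_sub_right, inner_add_right, inner_add_right, hi]
  simp only [inner_psi3_map]
  have h : ∀ x : ℂ, x = 3 → x.re = 3 := by rintro _ rfl; norm_num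
  apply h
  simp [matA, matB]
  -- The expectation minus 3 is a polynomial in ζ divisible by ζ² - ζ + 1; the coefficient is the
  -- quotient.
  linear_combination (-(z12 ^ 2) ^ 3 + (z12 ^ 2) ^ 2 - 9 * z12 ^ 2 - 21) / 10 * z12_sq_sq

theorem strategy3_winProb : strategy3.winProb (gameZ 3) = 5 / 6 := by
  have h := re_inner_strategy3_biasOperator
  rw [QuantumStrategy.winProb_gameZ_three, h]
  norm_num

end StrategyValue

/-! ### The quantum value and the self-test. -/

section SelfTest

variable {HA HB : Type*} [NormedAddCommGroup HA] [InnerProductSpace ℂ HA] [FiniteDimensional ℂ HA]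
  [NormedAddCommGroup HB] [InnerProductSpace ℂ HB] [FiniteDimensional ℂ HB]

namespace QuantumStrategy

variable (S : QuantumStrategy (Fin 2) (Fin 2) (ZMod 3) (ZMod 3) HA HB)

theorem isCubicPair_obsA : IsCubicPair (R := Module.End ℂ HA) (S.obsA 0)
    ((1 - z12 ^ 2) • S.obsA 1) :=
  (S.isCubicUnitary_obsA 0).isCubicPair_smul (S.isCubicUnitary_obsA 1) star_z12_sq z12_sq_sq

theorem isCubicPair_obsB : IsCubicPair (R := Module.End ℂ HB) (S.obsB 0)
    (z12 ^ 2 • star (R := Module.End ℂ HB) (S.obsB 1)) :=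
  (S.isCubicUnitary_obsB 0).isCubicPair_smul_star (S.isCubicUnitary_obsB 1) star_z12_sq z12_sq_sq

theorem winProb_gameZ_three_le : S.winProb (gameZ 3) ≤ 5 / 6 := by
  have h := re_inner_biasOperator_le isTensorAction_tensorOp S.isCubicPair_obsA S.isCubicPair_obsB
    star_z12_sq z12_sq_sq S.norm_psi
  rw [winProb_gameZ_three]
  linarith

end QuantumStrategy

theorem quantumValue_gameZ_three : (gameZ 3).quantumValue = 5 / 6 := by
  have hmem : (5 / 6 : ℝ) ∈ {p : ℝ | ∃ (HA HB : Type) (_ : NormedAddCommGroup HA)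
      (_ : InnerProductSpace ℂ HA) (_ : FiniteDimensional ℂ HA) (_ : NormedAddCommGroup HB)
      (_ : InnerProductSpace ℂ HB) (_ : FiniteDimensional ℂ HB)
      (S : QuantumStrategy (Fin 2) (Fin 2) (ZMod 3) (ZMod 3) HA HB), S.winProb (gameZ 3) = p} :=
    ⟨_, _, _, _, inferInstance, _, _, inferInstance, strategy3, strategy3_winProb⟩
  have hle : ∀ p ∈ {p : ℝ | ∃ (HA HB : Type) (_ : NormedAddCommGroup HA)
      (_ : InnerProductSpace ℂ HA) (_ : FiniteDimensional ℂ HA) (_ : NormedAddCommGroup HB)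
      (_ : InnerProductSpace ℂ HB) (_ : FiniteDimensional ℂ HB)
      (S : QuantumStrategy (Fin 2) (Fin 2) (ZMod 3) (ZMod 3) HA HB), S.winProb (gameZ 3) = p},
      p ≤ 5 / 6 := by
    rintro p ⟨HA, HB, _, _, _, _, _, _, S, rfl⟩
    exact S.winProb_gameZ_three_le
  exact le_antisymm (csSup_le ⟨_, hmem⟩ hle) (le_csSup ⟨_, hle⟩ hmem)

theorem map_comp_left_eq_withJunk {KA KB JA JB : Type*} [NormedAddCommGroup KA]
    [InnerProductSpace ℂ KA] [NormedAddCommGroup KB] [InnerProductSpace ℂ KB]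
    [NormedAddCommGroup JA] [InnerProductSpace ℂ JA] [NormedAddCommGroup JB]
    [InnerProductSpace ℂ JB] {ψ : HA ⊗[ℂ] HB} {φ : KA ⊗[ℂ] KB} {junk : JA ⊗[ℂ] JB}
    {VA : HA →ₗ[ℂ] KA ⊗[ℂ] JA} {VB : HB →ₗ[ℂ] KB ⊗[ℂ] JB}
    (h : TensorProduct.map VA VB ψ = withJunk φ junk) {a : HA →ₗ[ℂ] HA} {x : KA →ₗ[ℂ] KA}
    (ha : ∀ w ∈ leftSupport ψ, VA (a w) = TensorProduct.map x LinearMap.id (VA w)) :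
    TensorProduct.map (VA ∘ₗ a) VB ψ = withJunk (TensorProduct.map x LinearMap.id φ) junk := by
  rw [withJunk_map, ← h, ← LinearMap.comp_apply, ← TensorProduct.map_comp, TensorProduct.map_id,
    LinearMap.id_comp]
  exact map_eq_of_eqOn_leftSupport ha VB

theorem map_comp_right_eq_withJunk {KA KB JA JB : Type*} [NormedAddCommGroup KA]
    [InnerProductSpace ℂ KA] [NormedAddCommGroup KB] [InnerProductSpace ℂ KB]
    [NormedAddCommGroup JA] [InnerProductSpace ℂ JA] [NormedAddCommGroup JB]
    [InnerProductSpace ℂ JB] {ψ : HA ⊗[ℂ] HB} {φ : KA ⊗[ℂ] KB} {junk : JA ⊗[ℂ] JB}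
    {VA : HA →ₗ[ℂ] KA ⊗[ℂ] JA} {VB : HB →ₗ[ℂ] KB ⊗[ℂ] JB}
    (h : TensorProduct.map VA VB ψ = withJunk φ junk) {b : HB →ₗ[ℂ] HB} {y : KB →ₗ[ℂ] KB}
    (hb : ∀ w ∈ rightSupport ψ, VB (b w) = TensorProduct.map y LinearMap.id (VB w)) :
    TensorProduct.map VA (VB ∘ₗ b) ψ = withJunk (TensorProduct.map LinearMap.id y φ) junk := by
  rw [withJunk_map, ← h, ← LinearMap.comp_apply, ← TensorProduct.map_comp, TensorProduct.map_id,
    LinearMap.id_comp]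
  exact map_eq_of_eqOn_rightSupport hb VA

end SelfTest

theorem mainTheorem1 : IsExactSelfTest.{u, v} (gameZ 3) strategy3 := by
  refine ⟨strategy3_winProb.trans quantumValue_gameZ_three.symm, ?_⟩
  intro HA HB _ _ _ _ _ _ T hT
  have hwin : T.winProb (gameZ 3) = 5 / 6 := hT.trans quantumValue_gameZ_three
  rw [QuantumStrategy.winProb_gameZ_three] at hwin
  have hmax := isMaximalState_of_inner_eq isTensorAction_tensorOp T.isCubicPair_obsA
    T.isCubicPair_obsB star_z12_sq z12_sq_sq T.norm_psi (by linarith)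
  obtain ⟨dA, dB, VA, VB, junk, hjunk, hψ, hA0, hA1, hB0, hB1⟩ :=
    hmax.exists_isometries T.isCubicPair_obsA T.isCubicPair_obsB T.norm_psi
  have hz : z12 ^ 2 * (1 - z12 ^ 2) = 1 := by rw [mul_comm]; exact conj_mul_z12_sq
  refine ⟨dA, dB, VA, VB, junk, hjunk, hψ, fun i => ?_, fun j => ?_⟩
  · refine map_comp_left_eq_withJunk hψ fun w hw => ?_
    rw [strategy3_obsA]
    fin_cases i
    · exact hA0 w hw
    · refine Eq.trans ?_ (hA1 w hw)
      change VA (T.obsA 1 w) = z12 ^ 2 • VA ((1 - z12 ^ 2) • T.obsA 1 w)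
      rw [VA.map_smul, smul_smul, hz, one_smul]
  · refine map_comp_right_eq_withJunk hψ fun w hw => ?_
    rw [strategy3_obsB]
    fin_cases j
    · exact hB0 w hw
    · refine Eq.trans ?_ (hB1 w hw)
      rw [star_smul, star_star, star_z12_sq]
      change VB (T.obsB 1 w) = z12 ^ 2 • VB ((1 - z12 ^ 2) • T.obsB 1 w)
      rw [VB.map_smul, smul_smul, hz, one_smul]
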